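/- **Setting.** Let $n\ge 1$, let $U\subset\mathbb R^{n+1}$ be open and let $M\subset U$ be a relatively closed domain with $C^3$ boundary: near each point of $\partial M$ (the boundary of $M$ in $U$), $M=\{f\le 0\}$ for a $C^3$ function $f$ with $\nabla f\ne 0$. Let $\mathcal T_{\partial M}C^k_c(U;\mathbb R^{n+1})$ be the set of $X\in C^k_c(U;\mathbb R^{n+1})$ with $X(x)\in T_x(\partial M)$ for all $x\in\partial M$. An $n$-varifold $V$ on $U$ is a Radon measure on $U\times G(n+1,n)$, and $\|V\|$ is its mass measure, the push-forward to $U$. For $A\subset U$ relatively closed, $\mathbb V_n(A)$ is the set of $n$-varifolds $V$ on $U$ with $\operatorname{supp}\|V\|\subset A$, and $\mathbb{IV}_n(A)$ is the subset of the integral ones, $V=\Theta\,\mathcal H^n\llcorner_\Gamma\otimes\delta_{T_x\Gamma}$ with $\Gamma$ countably $n$-rectifiable and $\Theta$ positive-integer valued. Put $\mathrm{div}_S X=\mathrm{tr}(S\,\nabla X)$, where $S$ also denotes the orthogonal projection onto the plane $S$. For $(V,W)\in\mathbb V_n(M)\times\mathbb V_n(\partial M)$, $\theta\in(0,\pi)$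 and $a=\cos\theta$, the pair $(V,W)$ has *contact angle* $\theta$ in $M$ with mean curvature $H\in L^1(M,\|V\|;\mathbb R^{n+1})$ if $H(x)\in T_x(\partial M)$ for $\|V\|$-a.e. $x\in\partial M$ and $$\int\mathrm{div}_SX\,dV(x,S)+a\int\mathrm{div}_SX\,dW(x,S)=-\int_M X\cdot H\,d\|V\|\qquad\text{for all }X\in\mathcal T_{\partial M}C^1_c(U;\mathbb R^{n+1}).$$ Let $\theta\in(0,\pi/2]$ and $a=\cos\theta$. A family $\{(V_t,W_t)\}_{t\ge0}$ in $\mathbb V_n(M)\times\mathbb V_n(\partial M)$ is a *Brakke flow with contact angle $\theta$ in $M\subset U$*, with mean curvature $H$, if * (i) for a.e. $t\ge0$, $(V_t,W_t)\in\mathbb{IV}_n(M)\times\mathbb{IV}_n(\partial M)$ has contact angle $\theta$ with mean curvature $H(\cdot,t)$, where $H\in L^1_{loc}([0,\infty);L^2_{loc}(M,\|V_t\|;\mathbb R^{n+1}))$, and $H(x,t)\in T_x(\partial M)$ for a.e. $t\geq 0$ and $\mathcal H^n$-a.e. $x\in\partial M$; * (ii) $\sup_{t\in[0,T]}(\|V_t\|+\|W_t\|)(K)<\infty$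 for all $T>0$ and all compact $K\subset M$; * (iii) for all $0\le t_1<t_2<\infty$ and all $\phi\in C^1_c(U\times[0,\infty);[0,\infty))$ with $\nabla\phi(\cdot,t)\in\mathcal T_{\partial M}C^0_c(U;\mathbb R^{n+1})$ for all $t>0$, $$(\|V_t\|+a\|W_t\|)(\phi(\cdot,t))\Big|_{t=t_1}^{t_2}\le\int_{t_1}^{t_2}\Big(\int_M(\nabla\phi-\phi H)\cdot H\,d\|V_t\|+\int_M\partial_t\phi\,d(\|V_t\|+a\|W_t\|)\Big)dt,$$ where the integrals in time are required to make sense (the right-hand side being $-\infty$ if $\int_{t_1}^{t_2}\!\int_M\phi|H|^2\,d\|V_t\|\,dt=\infty$, so that the inequality then fails). **Lemma.** Let $U$ and $M$ be as above. 1. For every $C_0:\{K\subset M\text{ compact}\}\to[0,\infty)$ and every $\phi\in C^2_c(U;[0,\infty))$ with $\nabla\phi\in\mathcal T_{\partial M}C^1_c(U;\mathbb R^{n+1})$ there is a constant $C_1=C_1(C_0,\phi)>0$ such that, for every $\theta\in(0,\pi/2]$ and every Brakke flow $\{(V_t,W_t)\}_{t\ge0}$ with contact angle $\theta$ in $M\subset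 U$ satisfying $$\sup_{t\ge0}(\|V_t\|+a\|W_t\|)(K)\le C_0(K)\quad\text{for all compact }K\subset M,\qquad a=\cos\theta,\tag{$*$}$$ the function $t\mapsto(\|V_t\|+a\|W_t\|)(\phi)-C_1t$ is nonincreasing on $[0,\infty)$. 2. For every Brakke flow with contact angle $\theta\in(0,\pi/2]$ in $M\subset U$ that satisfies $(*)$ for some $C_0$, the limits below exist in the sense of weak convergence of Radon measures on $U$ (tested against $C^0_c(U)$) and satisfy $$\lim_{s\to t+0}(\|V_s\|+a\|W_s\|)\le\|V_t\|+a\|W_t\|\ \ (t\ge0),\qquad \|V_t\|+a\|W_t\|\le\lim_{s\to t-0}(\|V_s\|+a\|W_s\|)\ \ (t>0),$$ where $\mu\le\nu$ means $\mu(\phi)\le\nu(\phi)$ for all $\phi\in C^0_c(U;[0,\infty))$. 3. For all $0\le t_1<t_2<\infty$, all $\phi\in C^0_c(U;[0,\infty))$, all compact $K\subset U$ with $\operatorname{supp}\phi$ contained in the interior of $K$, and all $c\ge0$, there is a constant $C_2=C_2(c,K,\phi,t_1,t_2)>0$ such that, for every $\theta\in(0,\pi/2]$ and every Brakke flow with contact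 angle $\theta$ in $M\subset U$ and mean curvature $H$ satisfying $\sup_{t\ge0}(\|V_t\|+a\|W_t\|)(K)\le c$, $$\int_{t_1}^{t_2}\int_M\phi\,|H|^2\,d\|V_t\|\,dt\le C_2 .$$ -/

import Mathlib

open MeasureTheory Set Filter Topology
open scoped ENNReal NNReal

noncomputable section

namespace CapillaryBrakke

/-- The ambient Euclidean space `ℝ^{n+1}`. -/
abbrev E (n : ℕ) : Type := EuclideanSpace ℝ (Fin (n + 1))

/-- The Grassmannian `G(n+1, n)` of unoriented `n`-dimensional linear subspaces of `ℝ^{n+1}`, each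
subspace `S` being identified with the orthogonal projection onto it. It carries the topology and
the Borel `σ`-algebra induced by the operator norm. -/
abbrev Gr (n : ℕ) : Type :=
  {P : E n →L[ℝ] E n // IsStarProjection P ∧ Module.finrank ℝ (LinearMap.range P.toLinearMap) = n}

/-- The linear subspace (as a set) that a point of the Grassmannian represents. -/
def Gr.plane {n : ℕ} (S : Gr n) : Set (E n) := Set.range S.1

/-! ### Domains with `C³` boundary -/

/-- `f` is a `C³` defining function of `M` at `x`: near `x`, `M = {f ≤ 0}`, and `∇f(x) ≠ 0`. -/
def IsDefiningFunction {n : ℕ} (M : Set (E n)) (f : E n → ℝ) (x : E n) : Prop :=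
  ContDiffAt ℝ 3 f x ∧ fderiv ℝ f x ≠ 0 ∧ ∀ᶠ y in 𝓝 x, (y ∈ M ↔ f y ≤ 0)

/-- The boundary `∂M` of `M` inside the open set `U`. -/
def bdry {n : ℕ} (U M : Set (E n)) : Set (E n) := frontier M ∩ U

/-- `M ⊆ U` is a relatively closed domain in the open set `U` with `C³` boundary. -/
structure IsC3Domain {n : ℕ} (U M : Set (E n)) : Prop where
  subset : M ⊆ U
  relClosed : closure M ∩ U ⊆ M
  c3_boundary : ∀ x ∈ bdry U M, ∃ f, IsDefiningFunction M f x

/-- The tangent space `T_x(∂M)` at a boundary point `x`, namely `ker df(x)` for a `C³` defining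
function `f` of `M` at `x`. (All defining functions at a boundary point have parallel
differentials, so that the kernel does not depend on `f`.) -/
def bdryTangent {n : ℕ} (M : Set (E n)) (x : E n) : Set (E n) :=
  {v | ∃ f, IsDefiningFunction M f x ∧ fderiv ℝ f x v = 0}

/-! ### Test functions -/

/-- `φ ∈ C^0_c(U)`. -/
structure IsC0Test {n : ℕ} (U : Set (E n)) (φ : E n → ℝ) : Prop where
  continuous : Continuous φ
  compactSupport : HasCompactSupport φ
  support_subset : tsupport φ ⊆ U

/-- `X ∈ 𝒯_{∂M} C^1_c(U; ℝ^{n+1})`: a `C^1` vector field with compact support in `U` that is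
tangential to `∂M` at every point of `∂M`. -/
structure IsTangentialField {n : ℕ} (U M : Set (E n)) (X : E n → E n) : Prop where
  contDiff : ContDiff ℝ 1 X
  compactSupport : HasCompactSupport X
  support_subset : tsupport X ⊆ U
  tangential : ∀ x ∈ bdry U M, X x ∈ bdryTangent M x

/-- `φ ∈ C^2_c(U; [0,∞))` with `∇φ ∈ 𝒯_{∂M} C^1_c(U; ℝ^{n+1})`. -/
structure IsAdmissible {n : ℕ} (U M : Set (E n)) (φ : E n → ℝ) : Prop where
  contDiff : ContDiff ℝ 2 φ
  compactSupport : HasCompactSupport φ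
  support_subset : tsupport φ ⊆ U
  nonneg : ∀ x, 0 ≤ φ x
  gradient_tangential : IsTangentialField U M (gradient φ)

/-- `φ ∈ C^1_c(U × [0,∞); [0,∞))` with `∇φ(·,t) ∈ 𝒯_{∂M} C^0_c(U; ℝ^{n+1})` for all `t > 0`
(`∇` is the spatial gradient). Functions of class `C^1_c` on `U × [0,∞)` are the restrictions of
functions of class `C^1_c` on `U × ℝ`; only the values at times `t ≥ 0` matter. -/
structure IsSpaceTimeTest {n : ℕ} (U M : Set (E n)) (φ : E n → ℝ → ℝ) : Prop where
  contDiff : ContDiff ℝ 1 (Function.uncurry φ)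
  compactSupport : HasCompactSupport (Function.uncurry φ)
  support_subset : tsupport (Function.uncurry φ) ⊆ U ×ˢ (univ : Set ℝ)
  nonneg : ∀ x, ∀ t, 0 ≤ t → 0 ≤ φ x t
  gradient_tangential : ∀ t, 0 < t → ∀ x ∈ bdry U M,
    gradient (fun y => φ y t) x ∈ bdryTangent M x

/-! ### Varifolds -/

/-- `μ` is a Radon measure on the open set `U`, regarded as a Borel measure on `ℝ^{n+1}` that does
not charge the complement of `U`. -/
structure IsRadonOn {n : ℕ} (U : Set (E n)) (μ : Measure (E n)) : Prop where
  compl_null : μ Uᶜ = 0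
  finite_of_isCompact : ∀ K ⊆ U, IsCompact K → μ K < ∞

/-- The mass measure `‖V‖` of an `n`-varifold `V`, the push-forward of `V` to `ℝ^{n+1}`. -/
def mass {n : ℕ} (V : Measure (E n × Gr n)) : Measure (E n) := V.map Prod.fst

/-- `V ∈ 𝕍_n(A)`, where `A ⊆ U` is relatively closed in `U`: `V` is an `n`-varifold on `U`, that is,
a Radon measure on `G_n(U) = U × G(n+1,n)` (regarded as a measure on `ℝ^{n+1} × G(n+1,n)`), and
`supp ‖V‖ ⊆ A`. As `G(n+1,n)` is compact, a Borel measure on `G_n(U)` is Radon exactly when its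
mass measure is finite on the compact subsets of `U`. -/
structure IsVarifold {n : ℕ} (U A : Set (E n)) (V : Measure (E n × Gr n)) : Prop where
  radon : IsRadonOn U (mass V)
  supported : mass V Aᶜ = 0

/-- `Γ` is countably `n`-rectifiable: up to an `ℋ^n`-null set it is covered by countably many
Lipschitz images of `ℝ^n`. -/
def IsCountablyRectifiable {n : ℕ} (Γ : Set (E n)) : Prop :=
  ∃ f : ℕ → EuclideanSpace ℝ (Fin n) → E n,
    (∀ i, ∃ L : ℝ≥0, LipschitzWith L (f i)) ∧ μHE[n] (Γ \ ⋃ i, Set.range (f i)) = 0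

/-- The plane `S` is the approximate tangent plane of the measure `μ` at `x`: the blow-ups
`r^{-n} μ(x + r ·)` converge, as `r → 0+`, to a positive multiple of `ℋ^n ⌞ S`. -/
def IsApproxTangentPlane {n : ℕ} (μ : Measure (E n)) (x : E n) (S : Gr n) : Prop :=
  ∃ c : ℝ, 0 < c ∧ ∀ f : E n → ℝ, Continuous f → HasCompactSupport f →
    Tendsto (fun r : ℝ => (r ^ n)⁻¹ * ∫ y, f (r⁻¹ • (y - x)) ∂μ) (𝓝[>] 0)
      (𝓝 (c * ∫ y in S.plane, f y ∂μHE[n]))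

/-- `V ∈ 𝕀𝕍_n(A)`: the varifold `V` is integral, that is,
`V = Θ ℋ^n ⌞ Γ ⊗ δ_{T_x Γ}` for a countably `n`-rectifiable set `Γ` and a multiplicity `Θ` with
positive integer values on `Γ`. -/
structure IsIntegralVarifold {n : ℕ} (U A : Set (E n)) (V : Measure (E n × Gr n)) : Prop where
  varifold : IsVarifold U A V
  rectifiable : ∃ (Γ : Set (E n)) (Θ : E n → ℕ), MeasurableSet Γ ∧ IsCountablyRectifiable Γ ∧
    Measurable Θ ∧ (∀ x ∈ Γ, 0 < Θ x) ∧
    mass V = (μHE[n].restrict Γ).withDensity (fun x => (Θ x : ℝ≥0∞))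
  tangent : ∀ᵐ p ∂V, IsApproxTangentPlane (mass V) p.1 p.2

/-- `div_S X(x) = tr(S ∇X(x))`. -/
def divPlane {n : ℕ} (S : Gr n) (X : E n → E n) (x : E n) : ℝ :=
  LinearMap.trace ℝ (E n) (S.1 ∘L fderiv ℝ X x).toLinearMap

/-- The first variation `δV(X)`. -/
def firstVariation {n : ℕ} (V : Measure (E n × Gr n)) (X : E n → E n) : ℝ :=
  ∫ p, divPlane p.2 X p.1 ∂V

/-- `(V, W)` has the contact angle `θ` in `M`, with generalized mean curvature vector `H`. -/
structure HasContactAngle {n : ℕ} (U M : Set (E n)) (θ : ℝ) (V W : Measure (E n × Gr n))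
    (H : E n → E n) : Prop where
  integrable : Integrable H (mass V)
  tangential : ∀ᵐ x ∂(mass V), x ∈ bdry U M → H x ∈ bdryTangent M x
  first_variation : ∀ X, IsTangentialField U M X →
    firstVariation V X + Real.cos θ * firstVariation W X = - ∫ x, inner ℝ (X x) (H x) ∂(mass V)

/-- The capillary measure `‖V‖ + a ‖W‖` with `a = cos θ` (where `cos θ ≥ 0`). -/
def capMass {n : ℕ} (θ : ℝ) (V W : Measure (E n × Gr n)) : Measure (E n) :=
  mass V + ENNReal.ofReal (Real.cos θ) • mass W

/-! ### Brakke flows with contact angle -/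

/-- Brakke's inequality for the test function `φ` on `[t₁, t₂]`:
`(‖V_t‖ + a‖W_t‖)(φ(·,t)) |_{t₁}^{t₂} ≤ ∫_{t₁}^{t₂} ∫ (∇φ - φ H)·H d‖V_t‖ + ∂_tφ d(‖V_t‖ + a‖W_t‖) dt`.
The nonnegative, possibly infinite quantity `∫_{t₁}^{t₂} ∫ φ |H|² d‖V_t‖ dt` is written on the left
(so if it is infinite, the inequality fails); the remaining integral in time has to
make sense. -/
def BrakkeInequality {n : ℕ} (θ : ℝ) (V W : ℝ → Measure (E n × Gr n)) (H : ℝ → E n → E n)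
    (φ : E n → ℝ → ℝ) (t₁ t₂ : ℝ) : Prop :=
  let rate : ℝ → ℝ := fun t =>
    (∫ x, inner ℝ (gradient (fun y => φ y t) x) (H t x) ∂(mass (V t))) +
      (∫ x, deriv (fun s => φ x s) t ∂(capMass θ (V t) (W t)))
  IntervalIntegrable rate volume t₁ t₂ ∧
    ((∫⁻ t in Ioc t₁ t₂, ∫⁻ x, ENNReal.ofReal (φ x t * ‖H t x‖ ^ 2) ∂(mass (V t)) : ℝ≥0∞) : EReal)
      ≤ (((∫ x, φ x t₁ ∂(capMass θ (V t₁) (W t₁))) - (∫ x, φ x t₂ ∂(capMass θ (V t₂) (W t₂)))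
          + (∫ t in t₁..t₂, rate t) : ℝ) : EReal)

/-- `{(V_t, W_t)}_{t ≥ 0}` is an `n`-dimensional Brakke flow with contact angle `θ` in `M ⊆ U`, with
mean curvature `H(x,t) = H t x`. Only the times `t ≥ 0` matter. -/
structure IsBrakkeFlow {n : ℕ} (U M : Set (E n)) (θ : ℝ) (V W : ℝ → Measure (E n × Gr n))
    (H : ℝ → E n → E n) : Prop where
  angle_pos : 0 < θ
  angle_le : θ ≤ Real.pi / 2
  varifold : ∀ t, 0 ≤ t → IsVarifold U M (V t) ∧ IsVarifold U (bdry U M) (W t)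
  integral : ∀ᵐ t ∂(volume.restrict (Ici (0 : ℝ))),
    IsIntegralVarifold U M (V t) ∧ IsIntegralVarifold U (bdry U M) (W t)
  contactAngle : ∀ᵐ t ∂(volume.restrict (Ici (0 : ℝ))), HasContactAngle U M θ (V t) (W t) (H t)
  tangential : ∀ᵐ t ∂(volume.restrict (Ici (0 : ℝ))),
    ∀ᵐ x ∂(μHE[n].restrict (bdry U M)), H t x ∈ bdryTangent M x
  /-- `H ∈ L^1_loc([0,∞); L^2_loc(M, ‖V_t‖; ℝ^{n+1}))`. -/
  meanCurvature : ∀ K ⊆ M, IsCompact K →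
    (∀ᵐ t ∂(volume.restrict (Ici (0 : ℝ))), MemLp (H t) 2 ((mass (V t)).restrict K)) ∧
    AEMeasurable (fun t => eLpNorm (H t) 2 ((mass (V t)).restrict K))
      (volume.restrict (Ici (0 : ℝ))) ∧
    ∀ T : ℝ, ∫⁻ t in Icc 0 T, eLpNorm (H t) 2 ((mass (V t)).restrict K) < ∞
  mass_bound : ∀ T : ℝ, ∀ K ⊆ M, IsCompact K →
    ∃ C : ℝ≥0, ∀ t ∈ Icc 0 T, (mass (V t) + mass (W t)) K ≤ C
  brakke : ∀ t₁ t₂ : ℝ, 0 ≤ t₁ → t₁ < t₂ → ∀ φ, IsSpaceTimeTest U M φ →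
    BrakkeInequality θ V W H φ t₁ t₂

/-- `sup_{t ≥ 0} (‖V_t‖ + a‖W_t‖)(K) ≤ C₀(K)` for all compact sets `K ⊆ M`. -/
def HasMassBound {n : ℕ} (M : Set (E n)) (C₀ : Set (E n) → ℝ≥0) (θ : ℝ)
    (V W : ℝ → Measure (E n × Gr n)) : Prop :=
  ∀ K ⊆ M, IsCompact K → ∀ t, 0 ≤ t → capMass θ (V t) (W t) K ≤ C₀ K

end CapillaryBrakke

end

noncomputable section

namespace CapillaryBrakke

/-! ### Tangent spaces of the boundary -/

section Geometry

variable {n : ℕ} {U M : Set (E n)}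

/-! Test Brakke's inequality with an admissible `φ` that does not depend on time on `[t₁, t₂]`. The
time derivative disappears, and the only term without a sign is `∫ ∇φ · H d‖V_t‖`. Since `∇φ` is a
`C¹` field tangential to `∂M`, the contact angle identity turns this term into minus the first
variation of the pair along `∇φ`. It is therefore at most `(n + 1) sup ‖D(∇φ)‖` times the capillary
mass of a compact set containing the support (`integral_gradient_le`). Hence the dissipation is
bounded by the decrease of `(‖V_t‖ + a‖W_t‖)(φ)` plus a multiple of `t₂ - t₁` that does not see the
individual flow (`exists_dissipation_bound`). Discarding the nonnegative dissipation gives almost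
monotonicity; keeping it gives the space-time bound, once a general `φ` is replaced by an admissible
majorant.

One-sided limits on admissible functions follow from monotonicity. To reach all of `C^0_c(U)` one
needs enough functions with vanishing normal derivative on `∂M`. Near a boundary point they come
from correcting `|y - x₀|²` by a multiple of the defining function (`neumannDist`). Such functions
form an algebra separating points, so Stone-Weierstrass yields uniform approximation
(`exists_isAdmissible_near`). The limit functional is positive, and Riesz-Markov-Kakutani represents
it by a Radon measure (`exists_isRadonOn_tendsto`). -/

lemma fderiv_apply_gradient_comm (f g : E n → ℝ) (x : E n) :
    fderiv ℝ f x (gradient g x) = fderiv ℝ g x (gradient f x) := by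
  rw [← inner_gradient_left, ← inner_gradient_left, real_inner_comm]

lemma gradient_ne_zero {f : E n → ℝ} {x : E n} (h : fderiv ℝ f x ≠ 0) : gradient f x ≠ 0 := by
  intro h0
  apply h
  rw [← toDual_gradient, h0, map_zero]

lemma contDiffAt_gradient {f : E n → ℝ} {x : E n} {k m : WithTop ℕ∞}
    (hf : ContDiffAt ℝ k f x) (hmk : m + 1 ≤ k) : ContDiffAt ℝ m (gradient f) x := by
  rw [contDiffAt_euclidean]
  intro i
  have h : (fun y => gradient f y i) = fun y => fderiv ℝ f y (EuclideanSpace.single i 1) := by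
    ext y
    rw [← inner_gradient_left, EuclideanSpace.inner_single_right]
    simp
  rw [h]
  exact (hf.fderiv_right hmk).clm_apply contDiffAt_const

lemma IsDefiningFunction.eventually {f : E n → ℝ} {x : E n} (hf : IsDefiningFunction M f x) :
    ∀ᶠ y in 𝓝 x, IsDefiningFunction M f y := by
  obtain ⟨h1, h2, h3⟩ := hf
  have hc : ContinuousAt (fderiv ℝ f) x :=
    (h1.fderiv_right (m := 2) (by norm_num)).continuousAt
  filter_upwards [h1.eventually (by decide), hc.eventually_ne h2, h3.eventually_nhds]
    with y a b c using ⟨a, b, c⟩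

lemma IsDefiningFunction.eq_zero {f : E n → ℝ} {x : E n} (hf : IsDefiningFunction M f x)
    (hx : x ∈ frontier M) : f x = 0 := by
  have hc : ContinuousAt f x := hf.1.continuousAt
  rcases lt_trichotomy (f x) 0 with h | h | h
  · have : M ∈ 𝓝 x := by
      filter_upwards [hf.2.2, hc.eventually_lt_const h] with y h1 h2 using h1.2 h2.le
    exact absurd (mem_interior_iff_mem_nhds.2 this) hx.2
  · exact h
  · have : Mᶜ ∈ 𝓝 x := by
      filter_upwards [hf.2.2, hc.eventually_const_lt h] with y h1 h2
      exact fun hy => absurd (h1.1 hy) (not_le.2 h2)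
    have h3 := mem_interior_iff_mem_nhds.2 this
    rw [interior_compl] at h3
    exact absurd hx.1 h3

/-- A direction in which `f` strictly decreases enters `M`, where `g ≤ 0 = g x`; so the one-sided
difference quotients of `g` are nonpositive. -/
lemma IsDefiningFunction.fderiv_nonpos {f g : E n → ℝ} {x v : E n}
    (hf : IsDefiningFunction M f x) (hg : IsDefiningFunction M g x) (hx : x ∈ frontier M)
    (hv : fderiv ℝ f x v < 0) : fderiv ℝ g x v ≤ 0 := by
  have hline : HasDerivAt (fun t : ℝ => x + t • v) v 0 := by
    simpa using ((hasDerivAt_id (0 : ℝ)).smul_const v).const_add x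
  have key : ∀ h : E n → ℝ, IsDefiningFunction M h x →
      Tendsto (fun t : ℝ => t⁻¹ * h (x + t • v)) (𝓝[>] 0) (𝓝 (fderiv ℝ h x v)) := by
    intro h hh
    have hd : HasFDerivAt h (fderiv ℝ h x) (x + (0 : ℝ) • v) := by
      simpa using (hh.1.differentiableAt (by norm_num)).hasFDerivAt
    have := (hd.comp_hasDerivAt (0 : ℝ) hline).tendsto_slope_zero_right
    simpa [hh.eq_zero hx] using this
  have hcont : Tendsto (fun t : ℝ => x + t • v) (𝓝[>] 0) (𝓝 x) := by
    simpa using hline.continuousAt.tendsto.mono_left (nhdsWithin_le_nhds (s := Ioi 0))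
  refine le_of_tendsto (key g hg) ?_
  filter_upwards [(key f hf).eventually_lt_const hv, hcont.eventually hf.2.2,
    hcont.eventually hg.2.2, self_mem_nhdsWithin] with t h1 h2 h3 (ht : 0 < t)
  have hft : f (x + t • v) ≤ 0 := by
    by_contra hcon
    have := mul_pos (inv_pos.2 ht) (not_le.1 hcon)
    linarith
  exact mul_nonpos_of_nonneg_of_nonpos (inv_pos.2 ht).le (h3.1 (h2.2 hft))

/-- This makes the tangent space independent of the defining function, so that a Neumann condition
checked for one of them holds for all. -/
lemma IsDefiningFunction.fderiv_eq_zero {f g : E n → ℝ} {x v : E n}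
    (hf : IsDefiningFunction M f x) (hg : IsDefiningFunction M g x) (hx : x ∈ frontier M)
    (hv : fderiv ℝ f x v = 0) : fderiv ℝ g x v = 0 := by
  have aux : ∀ u : E n, fderiv ℝ f x u = 0 → fderiv ℝ g x u ≤ 0 := by
    intro u hu
    -- `df(w) = -|∇f|² < 0`, so `u + t • w` is a strictly decreasing direction of `f` for each `t >
    -- 0`; the claim for `u` follows as `t → 0`. Applying it to `v` and `-v` gives equality.
    set w : E n := -gradient f x
    have hw : fderiv ℝ f x w < 0 := by
      have h0 : gradient f x ≠ 0 := gradient_ne_zero hf.2.1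
      have : fderiv ℝ f x w = -‖gradient f x‖ ^ 2 := by
        rw [map_neg, ← inner_gradient_left, real_inner_self_eq_norm_sq]
      rw [this]
      have := norm_pos_iff.2 h0
      nlinarith
    have hlim : Tendsto (fun t : ℝ => fderiv ℝ g x u + t * fderiv ℝ g x w) (𝓝[>] 0)
        (𝓝 (fderiv ℝ g x u)) := by
      have : Continuous fun t : ℝ => fderiv ℝ g x u + t * fderiv ℝ g x w := by fun_prop
      simpa using (this.tendsto 0).mono_left (nhdsWithin_le_nhds (s := Ioi 0))
    refine le_of_tendsto hlim ?_
    filter_upwards [self_mem_nhdsWithin] with t (ht : 0 < t)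
    have := hf.fderiv_nonpos hg hx (v := u + t • w) (by
      simpa [hu] using mul_neg_of_pos_of_neg ht hw)
    simpa using this
  have h2 := aux (-v) (by simp [hv])
  rw [map_neg] at h2
  linarith [aux v hv]

lemma smul_mem_bdryTangent {x v : E n} (c : ℝ) (hv : v ∈ bdryTangent M x) :
    c • v ∈ bdryTangent M x := by
  obtain ⟨f, hf, h⟩ := hv
  exact ⟨f, hf, by simp [h]⟩

lemma IsC3Domain.bdry_subset (hM : IsC3Domain U M) : bdry U M ⊆ M :=
  fun _ hx => hM.relClosed ⟨hx.1.1, hx.2⟩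

/-! ### Functions with vanishing normal derivative -/

/-- `p` is a `C²` function whose normal derivative vanishes on `∂M`. -/
structure IsNeumann (U M : Set (E n)) (p : E n → ℝ) : Prop where
  contDiff : ContDiff ℝ 2 p
  normal_deriv : ∀ x ∈ bdry U M, ∀ f, IsDefiningFunction M f x → fderiv ℝ p x (gradient f x) = 0

namespace IsNeumann

lemma differentiableAt {p : E n → ℝ} (hp : IsNeumann U M p) (x : E n) : DifferentiableAt ℝ p x :=
  hp.contDiff.differentiable (by norm_num) x

lemma const (c : ℝ) : IsNeumann U M (fun _ => c) :=
  ⟨contDiff_const, fun x _ f _ => by simp⟩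

lemma add {p q : E n → ℝ} (hp : IsNeumann U M p) (hq : IsNeumann U M q) :
    IsNeumann U M (fun x => p x + q x) :=
  ⟨hp.contDiff.add hq.contDiff, fun x hx f hf => by
    rw [fderiv_fun_add (hp.differentiableAt x) (hq.differentiableAt x)]
    simp [hp.normal_deriv x hx f hf, hq.normal_deriv x hx f hf]⟩

lemma mul {p q : E n → ℝ} (hp : IsNeumann U M p) (hq : IsNeumann U M q) :
    IsNeumann U M (fun x => p x * q x) :=
  ⟨hp.contDiff.mul hq.contDiff, fun x hx f hf => by
    rw [fderiv_fun_mul (hp.differentiableAt x) (hq.differentiableAt x)]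
    simp [hp.normal_deriv x hx f hf, hq.normal_deriv x hx f hf]⟩

lemma sum {ι : Type*} (s : Finset ι) {p : ι → E n → ℝ} (hp : ∀ i ∈ s, IsNeumann U M (p i)) :
    IsNeumann U M (fun x => ∑ i ∈ s, p i x) := by
  classical
  induction s using Finset.induction_on with
  | empty => simpa using const (U := U) (M := M) 0
  | insert a s ha ih =>
    simp only [Finset.sum_insert ha]
    exact (hp a (by simp)).add (ih fun i hi => hp i (by simp [hi]))

/-- A nonnegative Neumann function with compact support is an admissible test function. -/
lemma isAdmissible (hM : IsC3Domain U M) {p : E n → ℝ} (hp : IsNeumann U M p)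
    (hc : HasCompactSupport p) (hs : tsupport p ⊆ U) (h0 : ∀ x, 0 ≤ p x) :
    IsAdmissible U M p := by
  have hzero : ∀ x, x ∉ tsupport p → gradient p x = 0 := by
    intro x hx
    have : p =ᶠ[𝓝 x] fun _ => 0 := notMem_tsupport_iff_eventuallyEq.1 hx
    rw [this.gradient_eq, gradient_fun_const]
  have hsupp : tsupport (gradient p) ⊆ tsupport p := by
    refine closure_minimal (fun x hx => ?_) (isClosed_tsupport p)
    by_contra h
    exact hx (hzero x h)
  refine ⟨hp.contDiff, hc, hs, h0, ⟨?_, ?_, hsupp.trans hs, ?_⟩⟩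
  · exact contDiff_iff_contDiffAt.2 fun x =>
      contDiffAt_gradient hp.contDiff.contDiffAt (by norm_num)
  · exact hc.of_isClosed_subset (isClosed_tsupport _) hsupp
  · intro x hx
    obtain ⟨f, hf⟩ := hM.c3_boundary x hx
    exact ⟨f, hf, by rw [fderiv_apply_gradient_comm]; exact hp.normal_deriv x hx f hf⟩

end IsNeumann

/-! ### Construction of Neumann bump functions -/

/-- A modification of `|y - x₀|²` whose normal derivative on `{f = 0}` vanishes. -/
def neumannDist (f : E n → ℝ) (x₀ y : E n) : ℝ :=
  ‖y - x₀‖ ^ 2 + f y * (2 * (f y - fderiv ℝ f y (y - x₀)) / ‖gradient f y‖ ^ 2)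

/-- With `d = df(y - x₀)` and `N = |∇f|²`, Cauchy-Schwarz gives `d² ≤ N |y - x₀|²`, and `d² + 4f(f -
d) = (2f - d)²` is a square. The summand `f` in the numerator of the correction, invisible on `{f =
0}` to first order, is there to complete this square. -/
lemma half_norm_sq_le_neumannDist {f : E n → ℝ} {x₀ y : E n} (h : fderiv ℝ f y ≠ 0) :
    ‖y - x₀‖ ^ 2 / 2 ≤ neumannDist f x₀ y := by
  have hpos : 0 < ‖gradient f y‖ := norm_pos_iff.2 (gradient_ne_zero h)
  have hCS : |fderiv ℝ f y (y - x₀)| ≤ ‖gradient f y‖ * ‖y - x₀‖ := by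
    rw [← inner_gradient_left]; exact abs_real_inner_le_norm _ _
  have hsq : (fderiv ℝ f y (y - x₀)) ^ 2 ≤ ‖gradient f y‖ ^ 2 * ‖y - x₀‖ ^ 2 := by
    rw [← mul_pow, ← sq_abs]
    exact pow_le_pow_left₀ (abs_nonneg _) hCS 2
  unfold neumannDist
  set N := ‖gradient f y‖ ^ 2
  have hN : 0 < N := by positivity
  set d := fderiv ℝ f y (y - x₀)
  have : ‖y - x₀‖ ^ 2 + f y * (2 * (f y - d) / N) - ‖y - x₀‖ ^ 2 / 2
      = (N * ‖y - x₀‖ ^ 2 + 4 * f y * (f y - d)) / (2 * N) := by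
    field_simp
    ring
  have h2 : 0 ≤ (N * ‖y - x₀‖ ^ 2 + 4 * f y * (f y - d)) / (2 * N) := by
    apply div_nonneg _ (by positivity)
    nlinarith [sq_nonneg (2 * f y - d)]
  linarith

/-- The correction contains `df`, so a `C³` defining function is what makes the result `C²`. -/
lemma contDiffAt_neumannDist {f : E n → ℝ} {x₀ y : E n} (hf : IsDefiningFunction M f y) :
    ContDiffAt ℝ 2 (neumannDist f x₀) y := by
  have h1 : ContDiffAt ℝ 2 f y := hf.1.of_le (by norm_num)
  have h2 : ContDiffAt ℝ 2 (fderiv ℝ f) y := hf.1.fderiv_right (by norm_num)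
  have h3 : ContDiffAt ℝ 2 (gradient f) y := contDiffAt_gradient hf.1 (by norm_num)
  have h4 : ContDiffAt ℝ 2 (fun z : E n => z - x₀) y := contDiffAt_id.sub contDiffAt_const
  unfold neumannDist
  refine (h4.norm_sq ℝ).add (h1.mul ((contDiffAt_const.mul (h1.sub (h2.clm_apply h4))).div
    (h3.norm_sq ℝ) ?_))
  exact pow_ne_zero 2 (norm_ne_zero_iff.2 (gradient_ne_zero hf.2.1))

/-- Where `f = 0`, only the derivative of the factor `f` survives in the correction; along `∇f` it
contributes `|∇f|² · (-2d / |∇f|²) = -2d`, with `d = df(y - x₀)`, and cancels the `2d` coming from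
`|y - x₀|²`. -/
lemma fderiv_neumannDist {f : E n → ℝ} {x₀ y : E n} (hf : IsDefiningFunction M f y)
    (h0 : f y = 0) : fderiv ℝ (neumannDist f x₀) y (gradient f y) = 0 := by
  have h1 : DifferentiableAt ℝ f y := hf.1.differentiableAt (by norm_num)
  have h2 : DifferentiableAt ℝ (fderiv ℝ f) y :=
    (hf.1.fderiv_right (m := 2) (by norm_num)).differentiableAt (by norm_num)
  have h3 : DifferentiableAt ℝ (gradient f) y :=
    (contDiffAt_gradient (m := 2) hf.1 (by norm_num)).differentiableAt (by norm_num)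
  have h4 : HasFDerivAt (fun z : E n => z - x₀) (ContinuousLinearMap.id ℝ (E n)) y :=
    (hasFDerivAt_id y).sub_const x₀
  have hne : ‖gradient f y‖ ^ 2 ≠ 0 :=
    pow_ne_zero 2 (norm_ne_zero_iff.2 (gradient_ne_zero hf.2.1))
  have h5 : DifferentiableAt ℝ
      (fun z => 2 * (f z - fderiv ℝ f z (z - x₀)) / ‖gradient f z‖ ^ 2) y :=
    ((differentiableAt_const _).fun_mul (h1.fun_sub (h2.clm_apply h4.differentiableAt))).fun_mul
      ((h3.norm_sq ℝ).fun_inv hne)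
  have h6 := (h4.norm_sq).add (h1.hasFDerivAt.mul h5.hasFDerivAt)
  have h7 : fderiv ℝ (neumannDist f x₀) y = _ := h6.fderiv
  rw [h7]
  have h8 : fderiv ℝ f y (gradient f y) = ‖gradient f y‖ ^ 2 := by
    rw [← inner_gradient_left, real_inner_self_eq_norm_sq]
  simp only [h0, add_apply, smul_apply, h8, ContinuousLinearMap.comp_apply,
    innerSL_apply_apply, smul_eq_mul, nsmul_eq_mul, zero_mul, zero_add,
    ContinuousLinearMap.id_apply, inner_gradient_right, conj_trivial]
  generalize fderiv ℝ f y (y - x₀) = d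
  rw [div_mul_cancel₀ _ hne]
  push_cast
  ring

lemma exists_isNeumann_bump_of_mem_bdry {x₀ : E n} (hM : IsC3Domain U M) (hx₀ : x₀ ∈ bdry U M)
    {N : Set (E n)} (hN : N ∈ 𝓝 x₀) :
    ∃ p, IsNeumann U M p ∧ HasCompactSupport p ∧ tsupport p ⊆ N ∧ (∀ x, 0 ≤ p x) ∧ 0 < p x₀ := by
  classical
  obtain ⟨f, hf⟩ := hM.c3_boundary x₀ hx₀
  obtain ⟨R, hR, hball⟩ := Metric.mem_nhds_iff.1 (inter_mem hN hf.eventually)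
  -- `β` vanishes for `s ≥ R² / 8`. Since `neumannDist` is at least `|y - x₀|² / 2`, this covers `|y
  -- - x₀| ≥ R / 2`, so the cutoff extends by zero outside the ball of radius `R`.
  set β : ℝ → ℝ := fun s => Real.smoothTransition (1 - 8 * s / R ^ 2) with hβ
  have hβs : ContDiff ℝ 2 β := Real.smoothTransition.contDiff.comp (by fun_prop)
  set p : E n → ℝ := fun y => if y ∈ Metric.ball x₀ R then β (neumannDist f x₀ y) else 0 with hp
  have hin : ∀ y ∈ Metric.ball x₀ R, p =ᶠ[𝓝 y] fun z => β (neumannDist f x₀ z) := by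
    intro y hy
    filter_upwards [Metric.isOpen_ball.mem_nhds hy] with z hz using if_pos hz
  have hsupp : Function.support p ⊆ Metric.closedBall x₀ (R / 2) := by
    intro y hy
    by_contra hcon
    apply hy
    by_cases hyb : y ∈ Metric.ball x₀ R
    · rw [hp]
      simp only [hyb, if_true]
      apply Real.smoothTransition.zero_of_nonpos
      have h1 := half_norm_sq_le_neumannDist (x₀ := x₀) (hball hyb).2.2.1
      have h2 : R / 2 < ‖y - x₀‖ := by
        rw [Metric.mem_closedBall, dist_eq_norm] at hcon; exact not_le.1 hcon
      rw [sub_nonpos, one_le_div (by positivity)]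
      nlinarith
    · exact if_neg hyb
  have htsupp : tsupport p ⊆ Metric.closedBall x₀ (R / 2) :=
    closure_minimal hsupp Metric.isClosed_closedBall
  have hsub : Metric.closedBall x₀ (R / 2) ⊆ Metric.ball x₀ R :=
    Metric.closedBall_subset_ball (by linarith)
  have hout : ∀ y, y ∉ Metric.ball x₀ R → p =ᶠ[𝓝 y] fun _ => 0 := fun y hy =>
    notMem_tsupport_iff_eventuallyEq.1 fun h => hy (hsub (htsupp h))
  refine ⟨p, ⟨contDiff_iff_contDiffAt.2 fun y => ?_, fun y hy g hg => ?_⟩,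
    (isCompact_closedBall x₀ (R / 2)).of_isClosed_subset (isClosed_tsupport p) htsupp,
    (htsupp.trans hsub).trans fun y hy => (hball hy).1, fun y => ?_, ?_⟩
  · by_cases hyb : y ∈ Metric.ball x₀ R
    · exact (hβs.contDiffAt.comp y (contDiffAt_neumannDist (hball hyb).2)).congr_of_eventuallyEq
        (hin y hyb)
    · exact contDiffAt_const.congr_of_eventuallyEq (hout y hyb)
  · by_cases hyb : y ∈ Metric.ball x₀ R
    · have hfy : IsDefiningFunction M f y := (hball hyb).2
      -- By symmetry `dp(∇g) = dg(∇p)`. The direct computation is for `f`: it puts `∇p` in `ker df`,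
      -- which equals `ker dg`.
      rw [← fderiv_apply_gradient_comm]
      refine hfy.fderiv_eq_zero hg hy.1 ?_
      rw [fderiv_apply_gradient_comm, (hin y hyb).fderiv_eq]
      have h1 : DifferentiableAt ℝ β (neumannDist f x₀ y) :=
        hβs.differentiable (by norm_num) _
      have h2 : DifferentiableAt ℝ (neumannDist f x₀) y :=
        (contDiffAt_neumannDist hfy).differentiableAt (by norm_num)
      have h3 : HasFDerivAt (fun z => β (neumannDist f x₀ z)) _ y :=
        h1.hasDerivAt.comp_hasFDerivAt y h2.hasFDerivAt
      rw [h3.fderiv]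
      simp [fderiv_neumannDist hfy (hfy.eq_zero hy.1)]
    · rw [(hout y hyb).fderiv_eq]
      simp
  · rw [hp]
    dsimp only
    split_ifs
    · exact Real.smoothTransition.nonneg _
    · exact le_rfl
  · have h1 : p x₀ = β (neumannDist f x₀ x₀) := if_pos (Metric.mem_ball_self hR)
    have h2 : neumannDist f x₀ x₀ = 0 := by simp [neumannDist, hf.eq_zero hx₀.1]
    rw [h1, h2, hβ]
    exact Real.smoothTransition.pos_of_pos (by norm_num)

/-- Away from the frontier, an ordinary bump supported off it satisfies the Neumann condition
trivially. -/
lemma exists_isNeumann_bump {x₀ : E n} (hM : IsC3Domain U M) (hx₀ : x₀ ∈ U)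
    {N : Set (E n)} (hN : N ∈ 𝓝 x₀) :
    ∃ p, IsNeumann U M p ∧ HasCompactSupport p ∧ tsupport p ⊆ N ∧ (∀ x, 0 ≤ p x) ∧ 0 < p x₀ := by
  by_cases hb : x₀ ∈ frontier M
  · exact exists_isNeumann_bump_of_mem_bdry hM ⟨hb, hx₀⟩ hN
  · have hN' : N ∩ (frontier M)ᶜ ∈ 𝓝 x₀ :=
      inter_mem hN (isClosed_frontier.isOpen_compl.mem_nhds hb)
    obtain ⟨p, hp1, hp2, hp3, hp4, hp5⟩ := exists_contDiff_tsupport_subset (n := 2) hN'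
    refine ⟨p, ⟨hp3, fun x hx f _ => ?_⟩, hp2, hp1.trans inter_subset_left,
      fun x => (hp4 (mem_range_self x)).1, by rw [hp5]; exact one_pos⟩
    have : p =ᶠ[𝓝 x] fun _ => 0 :=
      notMem_tsupport_iff_eventuallyEq.1 fun h => (hp1 h).2 hx.1
    rw [this.fderiv_eq]
    simp

lemma exists_isNeumann_ge_one (hM : IsC3Domain U M) {K O : Set (E n)} (hK : IsCompact K)
    (hO : IsOpen O) (hKO : K ⊆ O) (hOU : O ⊆ U) :
    ∃ p, IsNeumann U M p ∧ HasCompactSupport p ∧ tsupport p ⊆ O ∧ (∀ x, 0 ≤ p x) ∧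
      ∀ x ∈ K, 1 ≤ p x := by
  have hex : ∀ x : K, ∃ p, IsNeumann U M p ∧ HasCompactSupport p ∧ tsupport p ⊆ O ∧
      (∀ y, 0 ≤ p y) ∧ 0 < p x := fun x =>
    exists_isNeumann_bump hM (hOU (hKO x.2)) (hO.mem_nhds (hKO x.2))
  choose p hpN hpc hps hp0 hpp using hex
  have hcont : ∀ x, Continuous (p x) := fun x => (hpN x).contDiff.continuous
  obtain ⟨t, ht⟩ := hK.elim_finite_subcover (fun x : K => {y | 0 < p x y})
    (fun x => isOpen_lt continuous_const (hcont x))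
    (fun x hx => mem_iUnion.2 ⟨⟨x, hx⟩, hpp ⟨x, hx⟩⟩)
  set q : E n → ℝ := fun y => ∑ x ∈ t, p x y with hq
  have hqN : IsNeumann U M q := IsNeumann.sum t fun i _ => hpN i
  have hq0 : ∀ y, 0 ≤ q y := fun y => Finset.sum_nonneg fun i _ => hp0 i y
  have hqs : tsupport q ⊆ ⋃ x ∈ t, tsupport (p x) := by
    refine closure_minimal (fun y hy => ?_)
      (t.finite_toSet.isClosed_biUnion fun i _ => isClosed_tsupport _)
    by_contra hcon
    apply hy
    refine Finset.sum_eq_zero fun i hi => ?_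
    by_contra h
    exact hcon (mem_biUnion hi (subset_tsupport _ h))
  have hqc : HasCompactSupport q :=
    (t.isCompact_biUnion fun i _ => hpc i).of_isClosed_subset (isClosed_tsupport _) hqs
  have hqO : tsupport q ⊆ O := hqs.trans (iUnion₂_subset fun i _ => hps i)
  have hqpos : ∀ y ∈ K, 0 < q y := by
    intro y hy
    obtain ⟨i, hi, hiy⟩ := mem_iUnion₂.1 (ht hy)
    exact lt_of_lt_of_le hiy (Finset.single_le_sum (f := fun i => p i y) (fun i _ => hp0 i y) hi)
  obtain ⟨m, hm, hmq⟩ : ∃ m : ℝ, 0 < m ∧ ∀ y ∈ K, m ≤ q y := by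
    rcases K.eq_empty_or_nonempty with rfl | hne
    · exact ⟨1, one_pos, by simp⟩
    · obtain ⟨y, hy, hmin⟩ := hK.exists_isMinOn hne hqN.contDiff.continuous.continuousOn
      exact ⟨q y, hqpos y hy, hmin⟩
  refine ⟨fun y => m⁻¹ * q y, (IsNeumann.const m⁻¹).mul hqN, hqc.mul_left,
    (tsupport_mul_subset_right (f := fun _ => m⁻¹) (g := q)).trans hqO,
    fun y => mul_nonneg (inv_pos.2 hm).le (hq0 y), fun y hy => ?_⟩
  exact (one_le_inv_mul₀ hm).2 (hmq y hy)

/-- Every compactly supported continuous function lies below an admissible one. -/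
lemma exists_isAdmissible_ge (hM : IsC3Domain U M) {O : Set (E n)} (hO : IsOpen O) (hOU : O ⊆ U)
    {φ : E n → ℝ} (hφ : Continuous φ) (hc : HasCompactSupport φ) (hs : tsupport φ ⊆ O) :
    ∃ ψ, IsAdmissible U M ψ ∧ tsupport ψ ⊆ O ∧ ∀ x, |φ x| ≤ ψ x := by
  obtain ⟨p, hp, hpc, hps, hp0, hp1⟩ := exists_isNeumann_ge_one hM hc hO hs hOU
  obtain ⟨C, hC⟩ := hc.exists_bound_of_continuous hφ
  have hC0 : 0 ≤ C := (norm_nonneg _).trans (hC 0)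
  have hs' : tsupport (fun y => C * p y) ⊆ O :=
    (tsupport_mul_subset_right (f := fun _ => C) (g := p)).trans hps
  refine ⟨fun y => C * p y, ((IsNeumann.const C).mul hp).isAdmissible hM hpc.mul_left
    (hs'.trans hOU) fun y => mul_nonneg hC0 (hp0 y), hs', fun x => ?_⟩
  by_cases hx : x ∈ tsupport φ
  · exact (hC x).trans (le_mul_of_one_le_right hC0 (hp1 x hx))
  · rw [image_eq_zero_of_notMem_tsupport hx, abs_zero]
    exact mul_nonneg hC0 (hp0 x)

/-- Nonnegative continuous functions with compact support are uniformly approximated by admissible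
ones, with an error controlled by a fixed admissible function. -/
lemma exists_isAdmissible_near (hU : IsOpen U) (hM : IsC3Domain U M) {φ : E n → ℝ}
    (hφ : IsC0Test U φ) (h0 : ∀ x, 0 ≤ φ x) :
    ∃ χ, IsAdmissible U M χ ∧ ∀ ε > 0, ∃ ψ, IsAdmissible U M ψ ∧
      ∀ x, |φ x - ψ x| ≤ ε * χ x := by
  obtain ⟨η, hη, hηc, hηs, hη0, hη1⟩ :=
    exists_isNeumann_ge_one hM hφ.compactSupport hU hφ.support_subset subset_rfl
  set K : Set (E n) := tsupport η
  have hKc : IsCompact K := hηc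
  have : CompactSpace K := isCompact_iff_compactSpace.1 hKc
  -- The Leibniz rule preserves vanishing normal derivatives, so restrictions of Neumann functions
  -- form an algebra, to which Stone-Weierstrass applies.
  let A : Subalgebra ℝ C(K, ℝ) :=
    { carrier := {g | ∃ p, IsNeumann U M p ∧ ∀ x : K, g x = p x}
      mul_mem' := by
        rintro a b ⟨p, hp, hap⟩ ⟨q, hq, hbq⟩
        exact ⟨_, hp.mul hq, fun x => by simp [hap, hbq]⟩
      add_mem' := by
        rintro a b ⟨p, hp, hap⟩ ⟨q, hq, hbq⟩
        exact ⟨_, hp.add hq, fun x => by simp [hap, hbq]⟩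
      algebraMap_mem' := fun r => ⟨_, IsNeumann.const r, fun x => by simp⟩ }
  have hA : A.SeparatesPoints := by
    intro x y hxy
    have hne : (x : E n) ≠ y := Subtype.coe_ne_coe.2 hxy
    obtain ⟨p, hp, -, hps, -, hpx⟩ := exists_isNeumann_bump hM (hηs x.2)
      (isOpen_compl_singleton.mem_nhds (show (x : E n) ∈ ({(y : E n)} : Set (E n))ᶜ from hne))
    refine ⟨_, ⟨⟨fun z : K => p z, hp.contDiff.continuous.comp continuous_subtype_val⟩,
      ⟨p, hp, fun _ => rfl⟩, rfl⟩, ?_⟩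
    have hpy : p y = 0 := image_eq_zero_of_notMem_tsupport fun h => hps h rfl
    simpa [hpy] using hpx.ne'
  have hηcont : Continuous η := hη.contDiff.continuous
  -- `φ = η * (φ / η)`, where `φ / η` is continuous because `η ≥ 1` on the support of `φ`
  set k : E n → ℝ := fun x => φ x / max (η x) 1 with hk
  have hkcont : Continuous k :=
    hφ.continuous.div (hηcont.max continuous_const) fun x =>
      (lt_of_lt_of_le one_pos (le_max_right _ _)).ne'
  have hφk : ∀ x, φ x = η x * k x := by
    intro x
    by_cases hx : x ∈ tsupport φ
    · rw [hk]
      dsimp only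
      rw [max_eq_left (hη1 x hx), mul_div_cancel₀]
      exact (lt_of_lt_of_le one_pos (hη1 x hx)).ne'
    · simp [hk, image_eq_zero_of_notMem_tsupport hx]
  have hk0 : ∀ x, 0 ≤ k x := fun x =>
    div_nonneg (h0 x) (zero_le_one.trans (le_max_right _ _))
  refine ⟨fun x => 2 * η x, ((IsNeumann.const 2).mul hη).isAdmissible hM hηc.mul_left
    ((tsupport_mul_subset_right (f := fun _ => (2 : ℝ)) (g := η)).trans hηs)
    fun x => mul_nonneg zero_le_two (hη0 x), fun ε hε => ?_⟩
  obtain ⟨⟨g, p, hp, hgp⟩, hg⟩ :=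
    ContinuousMap.exists_mem_subalgebra_near_continuous_of_separatesPoints A hA
      (fun x : K => k x) (hkcont.comp continuous_subtype_val) ε hε
  have hpk : ∀ x ∈ K, |p x - k x| < ε := by
    intro x hx
    have := hg ⟨x, hx⟩
    simpa [hgp ⟨x, hx⟩] using this
  have hηK : ∀ x ∉ K, η x = 0 := fun x hx => image_eq_zero_of_notMem_tsupport hx
  -- From `p > k - ε ≥ -ε` on `K`, adding `ε` ensures nonnegativity. It raises the error from `ε` to
  -- `2ε`, whence `χ = 2η`.
  refine ⟨fun x => η x * (p x + ε), (hη.mul (hp.add (IsNeumann.const ε))).isAdmissible hM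
    hηc.mul_right ((tsupport_mul_subset_left (f := η) (g := fun x => p x + ε)).trans hηs)
    fun x => ?_, fun x => ?_⟩
  · by_cases hx : x ∈ K
    · have := abs_lt.1 (hpk x hx)
      exact mul_nonneg (hη0 x) (by linarith [hk0 x])
    · simp [hηK x hx]
  · by_cases hx : x ∈ K
    · have := abs_lt.1 (hpk x hx)
      rw [hφk x, ← mul_sub, abs_mul, abs_of_nonneg (hη0 x)]
      have h2 : |k x - (p x + ε)| ≤ 2 * ε := abs_le.2 ⟨by linarith, by linarith⟩
      nlinarith [mul_le_mul_of_nonneg_left h2 (hη0 x)]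
    · simp [hφk x, hηK x hx]

end Geometry

/-! ### First variation and mass estimates -/

section Flow

variable {n : ℕ} {U M : Set (E n)}

/-- The trace is a sum of `n + 1` diagonal entries in an orthonormal basis, and an orthogonal
projection has norm at most one. -/
lemma abs_divPlane_le (S : Gr n) (X : E n → E n) (x : E n) :
    |divPlane S X x| ≤ (n + 1) * ‖fderiv ℝ X x‖ := by
  have hS : ‖S.1‖ ≤ 1 := IsStarProjection.norm_le _ S.2.1
  unfold divPlane
  rw [LinearMap.trace_eq_sum_inner _ (EuclideanSpace.basisFun (Fin (n + 1)) ℝ)]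
  refine (Finset.abs_sum_le_sum_abs _ _).trans ?_
  have : ∀ i ∈ Finset.univ, |inner ℝ (EuclideanSpace.basisFun (Fin (n + 1)) ℝ i)
      ((S.1 ∘L fderiv ℝ X x).toLinearMap (EuclideanSpace.basisFun (Fin (n + 1)) ℝ i))|
      ≤ ‖fderiv ℝ X x‖ := by
    intro i _
    set e := EuclideanSpace.basisFun (Fin (n + 1)) ℝ i
    have he : ‖e‖ = 1 := (EuclideanSpace.basisFun (Fin (n + 1)) ℝ).orthonormal.1 i
    calc |inner ℝ e ((S.1 ∘L fderiv ℝ X x) e)| ≤ ‖e‖ * ‖(S.1 ∘L fderiv ℝ X x) e‖ :=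
          abs_real_inner_le_norm _ _
      _ ≤ ‖e‖ * (‖S.1 ∘L fderiv ℝ X x‖ * ‖e‖) := by gcongr; exact ContinuousLinearMap.le_opNorm _ _
      _ = ‖S.1 ∘L fderiv ℝ X x‖ := by rw [he]; ring
      _ ≤ ‖S.1‖ * ‖fderiv ℝ X x‖ := ContinuousLinearMap.opNorm_comp_le _ _
      _ ≤ 1 * ‖fderiv ℝ X x‖ := by gcongr
      _ = ‖fderiv ℝ X x‖ := one_mul _
  refine (Finset.sum_le_sum this).trans (le_of_eq ?_)
  simp

lemma IsRadonOn.integrable {μ : Measure (E n)} (hμ : IsRadonOn U μ) {φ : E n → ℝ}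
    (hφ : IsC0Test U φ) : Integrable φ μ := by
  obtain ⟨C, hC⟩ := hφ.compactSupport.exists_bound_of_continuous hφ.continuous
  rw [← integrableOn_iff_integrable_of_support_subset (subset_tsupport φ)]
  exact Measure.integrableOn_of_bounded
    (hμ.finite_of_isCompact _ hφ.support_subset hφ.compactSupport).ne
    hφ.continuous.aestronglyMeasurable (Eventually.of_forall hC)

lemma IsAdmissible.isC0Test {φ : E n → ℝ} (hφ : IsAdmissible U M φ) : IsC0Test U φ :=
  ⟨hφ.contDiff.continuous, hφ.compactSupport, hφ.support_subset⟩

lemma abs_firstVariation_le {A K : Set (E n)} {V : Measure (E n × Gr n)} (hV : IsVarifold U A V)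
    {X : E n → E n} {B : ℝ} (hB : ∀ x, ‖fderiv ℝ X x‖ ≤ B) (hK : IsCompact K) (hKU : K ⊆ U)
    (hXK : tsupport X ⊆ K) :
    |firstVariation V X| ≤ (n + 1) * B * (mass V K).toReal := by
  have hVK : mass V K = V (Prod.fst ⁻¹' K) := Measure.map_apply measurable_fst hK.measurableSet
  have hfin : V (Prod.fst ⁻¹' K) < ∞ := hVK ▸ hV.radon.finite_of_isCompact K hKU hK
  have hzero : ∀ p : E n × Gr n, p ∉ Prod.fst ⁻¹' K → divPlane p.2 X p.1 = 0 := by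
    intro p hp
    have h0 : X =ᶠ[𝓝 p.1] fun _ => 0 :=
      notMem_tsupport_iff_eventuallyEq.1 fun h => hp (hXK h)
    have := abs_divPlane_le p.2 X p.1
    rw [h0.fderiv_eq] at this
    simpa using this
  unfold firstVariation
  rw [← setIntegral_eq_integral_of_forall_compl_eq_zero hzero, hVK, ← Real.norm_eq_abs]
  refine norm_setIntegral_le_of_norm_le_const hfin fun p _ => ?_
  rw [Real.norm_eq_abs]
  refine (abs_divPlane_le p.2 X p.1).trans ?_
  gcongr
  exact hB p.1

lemma capMass_apply (θ : ℝ) (V W : Measure (E n × Gr n)) (K : Set (E n)) :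
    capMass θ V W K = mass V K + ENNReal.ofReal (Real.cos θ) * mass W K := by
  simp [capMass]

lemma capMass_compl (hM : IsC3Domain U M) {θ : ℝ} {V W : Measure (E n × Gr n)}
    (hV : IsVarifold U M V) (hW : IsVarifold U (bdry U M) W) : capMass θ V W Mᶜ = 0 := by
  rw [capMass_apply, hV.supported,
    measure_mono_null (compl_subset_compl.2 hM.bdry_subset) hW.supported, mul_zero, zero_add]

lemma isRadonOn_capMass {A B : Set (E n)} {θ : ℝ} {V W : Measure (E n × Gr n)}
    (hV : IsVarifold U A V) (hW : IsVarifold U B W) : IsRadonOn U (capMass θ V W) := by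
  refine ⟨?_, fun K hKU hK => ?_⟩
  · rw [capMass_apply, hV.radon.compl_null, hW.radon.compl_null, mul_zero, zero_add]
  · rw [capMass_apply]
    exact ENNReal.add_lt_top.2 ⟨hV.radon.finite_of_isCompact K hKU hK,
      ENNReal.mul_lt_top ENNReal.ofReal_lt_top (hW.radon.finite_of_isCompact K hKU hK)⟩

lemma IsC3Domain.isCompact_inter (hM : IsC3Domain U M) {K : Set (E n)} (hK : IsCompact K)
    (hKU : K ⊆ U) : IsCompact (K ∩ M) := by
  have : K ∩ M = K ∩ closure M :=
    Subset.antisymm (inter_subset_inter_right _ subset_closure)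
      fun x hx => ⟨hx.1, hM.relClosed ⟨hx.2, hKU hx.1⟩⟩
  rw [this]
  exact hK.inter_right isClosed_closure

/-- The bound is given only for compact subsets of `M`, but the capillary measure lives on `M`, and
`K ∩ M` is compact because `M` is relatively closed in `U`. -/
lemma HasMassBound.capMass_le (hM : IsC3Domain U M) {C₀ : Set (E n) → ℝ≥0} {θ : ℝ}
    {V W : ℝ → Measure (E n × Gr n)} {H : ℝ → E n → E n} (hF : IsBrakkeFlow U M θ V W H)
    (hb : HasMassBound M C₀ θ V W) {K : Set (E n)} (hK : IsCompact K) (hKU : K ⊆ U) {t : ℝ}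
    (ht : 0 ≤ t) : capMass θ (V t) (W t) K ≤ C₀ (K ∩ M) := by
  obtain ⟨hV, hW⟩ := hF.varifold t ht
  have h0 : capMass θ (V t) (W t) (K \ M) = 0 :=
    measure_mono_null (fun x hx => hx.2) (capMass_compl hM hV hW)
  calc capMass θ (V t) (W t) K ≤ capMass θ (V t) (W t) (K ∩ M) + capMass θ (V t) (W t) (K \ M) :=
        measure_le_inter_add_sdiff _ _ _
    _ = capMass θ (V t) (W t) (K ∩ M) := by rw [h0, add_zero]
    _ ≤ C₀ (K ∩ M) := hb _ inter_subset_right (hM.isCompact_inter hK hKU) t ht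

/-! ### Brakke's inequality for time-independent test functions -/

lemma isSpaceTimeTest_mul {φ : E n → ℝ} (hφ : IsAdmissible U M φ) {η : ℝ → ℝ}
    (hη : ContDiff ℝ 1 η) (hηc : HasCompactSupport η) (hη0 : ∀ t, 0 ≤ η t) :
    IsSpaceTimeTest U M (fun x t => φ x * η t) := by
  have hsupp : tsupport (Function.uncurry fun x t => φ x * η t) ⊆ tsupport φ ×ˢ tsupport η := by
    refine closure_minimal (fun p hp => ?_) ((isClosed_tsupport φ).prod (isClosed_tsupport η))
    have hp' : φ p.1 * η p.2 ≠ 0 := hp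
    exact ⟨subset_tsupport φ (left_ne_zero_of_mul hp'),
      subset_tsupport η (right_ne_zero_of_mul hp')⟩
  refine ⟨?_, (hφ.compactSupport.prod hηc).of_isClosed_subset (isClosed_tsupport _) hsupp,
    hsupp.trans (prod_mono hφ.support_subset (subset_univ _)),
    fun x t _ => mul_nonneg (hφ.nonneg x) (hη0 t), fun t _ x hx => ?_⟩
  · exact ((hφ.contDiff.of_le (by norm_num)).comp contDiff_fst).mul (hη.comp contDiff_snd)
  · have h1 : HasGradientAt φ (gradient φ x) x :=
      (hφ.contDiff.differentiable (by norm_num) x).hasGradientAt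
    have h2 : HasGradientAt (fun y => φ y * η t) (η t • gradient φ x) x := by
      rw [hasGradientAt_iff_hasFDerivAt] at h1 ⊢
      simpa using h1.mul_const (η t)
    rw [h2.gradient]
    exact smul_mem_bdryTangent _ (hφ.gradient_tangential.tangential x hx)

/-- Space-time test functions must have compact support in time as well. Being `1` near each point
of the closed interval, the cutoff has zero derivative even at the endpoints. -/
lemma exists_timeCutoff (t₁ t₂ : ℝ) : ∃ η : ℝ → ℝ, ContDiff ℝ 1 η ∧ HasCompactSupport η ∧
    (∀ t, 0 ≤ η t) ∧ ∀ t ∈ Icc t₁ t₂, η =ᶠ[𝓝 t] fun _ => 1 := by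
  let b : ContDiffBump (0 : ℝ) := ⟨|t₁| + |t₂| + 1, |t₁| + |t₂| + 2, by positivity, by linarith⟩
  refine ⟨b, b.contDiff, b.hasCompactSupport, fun t => b.nonneg, fun t ht => ?_⟩
  apply b.eventuallyEq_one_of_mem_ball
  rw [Metric.mem_ball, dist_zero_right, Real.norm_eq_abs, abs_lt]
  change -(|t₁| + |t₂| + 1) < t ∧ t < |t₁| + |t₂| + 1
  constructor <;>
    linarith [ht.1, ht.2, neg_abs_le t₁, le_abs_self t₂, abs_nonneg t₁, abs_nonneg t₂]

lemma IsBrakkeFlow.cos_nonneg {θ : ℝ} {V W : ℝ → Measure (E n × Gr n)} {H : ℝ → E n → E n}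
    (hF : IsBrakkeFlow U M θ V W H) : 0 ≤ Real.cos θ :=
  Real.cos_nonneg_of_mem_Icc ⟨by linarith [hF.angle_pos, Real.pi_pos], hF.angle_le⟩

/-- The first variation identity with `X = ∇φ` trades the curvature for second derivatives of `φ`,
so no bound on `H` enters. Since `cos θ ≥ 0`, the estimates for `V` and `W` add up to the capillary
mass of `K`, making the bound uniform in `θ`. -/
lemma integral_gradient_le {θ : ℝ} (hθ : 0 ≤ Real.cos θ) {V W : Measure (E n × Gr n)}
    {H : E n → E n} (hV : IsVarifold U M V) (hW : IsVarifold U (bdry U M) W)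
    (hH : HasContactAngle U M θ V W H) {φ : E n → ℝ} (hφ : IsAdmissible U M φ)
    {B : ℝ} (hB : ∀ x, ‖fderiv ℝ (gradient φ) x‖ ≤ B) {K : Set (E n)} (hK : IsCompact K)
    (hKU : K ⊆ U) (hφK : tsupport φ ⊆ K) {c : ℝ≥0} (hc : capMass θ V W K ≤ c) :
    |∫ x, inner ℝ (gradient φ x) (H x) ∂(mass V)| ≤ (n + 1) * B * c := by
  have hXK : tsupport (gradient φ) ⊆ K := by
    refine (closure_minimal (fun x hx => ?_) (isClosed_tsupport φ)).trans hφK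
    by_contra h
    apply hx
    have : φ =ᶠ[𝓝 x] fun _ => 0 := notMem_tsupport_iff_eventuallyEq.1 h
    rw [this.gradient_eq, gradient_fun_const]
  have hB0 : 0 ≤ B := (norm_nonneg _).trans (hB 0)
  have h1 := abs_firstVariation_le hV hB hK hKU hXK
  have h2 := abs_firstVariation_le hW hB hK hKU hXK
  have h3 := hH.first_variation _ hφ.gradient_tangential
  have h4 : (mass V K).toReal + Real.cos θ * (mass W K).toReal ≤ c := by
    rw [capMass_apply] at hc
    have h5 := ENNReal.toReal_mono ENNReal.coe_ne_top hc
    rwa [ENNReal.toReal_add (hV.radon.finite_of_isCompact K hKU hK).ne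
      (ENNReal.mul_ne_top ENNReal.ofReal_ne_top (hW.radon.finite_of_isCompact K hKU hK).ne),
      ENNReal.toReal_mul, ENNReal.toReal_ofReal hθ, ENNReal.coe_toReal] at h5
  rw [← abs_neg, ← h3]
  calc |firstVariation V (gradient φ) + Real.cos θ * firstVariation W (gradient φ)|
      ≤ |firstVariation V (gradient φ)| + |Real.cos θ * firstVariation W (gradient φ)| :=
        abs_add_le _ _
    _ ≤ (n + 1) * B * (mass V K).toReal
        + Real.cos θ * ((n + 1) * B * (mass W K).toReal) := by
        rw [abs_mul, abs_of_nonneg hθ]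
        gcongr
    _ = (n + 1) * B * ((mass V K).toReal + Real.cos θ * (mass W K).toReal) := by ring
    _ ≤ (n + 1) * B * c := by gcongr

/-- Brakke's inequality for an admissible function of space: the dissipation is controlled by the
mass decrease, up to an error linear in time which depends only on the local mass bound. -/
lemma exists_dissipation_bound {φ : E n → ℝ} (hφ : IsAdmissible U M φ) {K : Set (E n)}
    (hK : IsCompact K) (hKU : K ⊆ U) (hφK : tsupport φ ⊆ K) (c : ℝ≥0) :
    ∃ C : ℝ, 0 < C ∧ ∀ θ V W H, IsBrakkeFlow U M θ V W H →
      (∀ t : ℝ, 0 ≤ t → capMass θ (V t) (W t) K ≤ c) → ∀ t₁ t₂ : ℝ, 0 ≤ t₁ → t₁ < t₂ →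
      ((∫⁻ t in Ioc t₁ t₂, ∫⁻ x, ENNReal.ofReal (φ x * ‖H t x‖ ^ 2) ∂(mass (V t)) : ℝ≥0∞) : EReal)
        ≤ (((∫ x, φ x ∂(capMass θ (V t₁) (W t₁))) - (∫ x, φ x ∂(capMass θ (V t₂) (W t₂)))
          + C * (t₂ - t₁) : ℝ) : EReal) := by
  have hX := hφ.gradient_tangential
  obtain ⟨B, hB⟩ := (hX.compactSupport.fderiv ℝ).exists_bound_of_continuous
    (hX.contDiff.continuous_fderiv (by norm_num))
  have hB0 : 0 ≤ B := (norm_nonneg _).trans (hB 0)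
  -- The `+ 1` only ensures strict positivity.
  refine ⟨(n + 1) * B * c + 1, by positivity, fun θ V W H hF hc t₁ t₂ ht₁ ht => ?_⟩
  obtain ⟨η, hη, hηc, hη0, hη1⟩ := exists_timeCutoff t₁ t₂
  obtain ⟨hint, hineq⟩ := hF.brakke t₁ t₂ ht₁ ht _ (isSpaceTimeTest_mul hφ hη hηc hη0)
  have hone : ∀ t ∈ Icc t₁ t₂, η t = 1 := fun t ht => (hη1 t ht).eq_of_nhds
  have hlhs : (∫⁻ t in Ioc t₁ t₂, ∫⁻ x, ENNReal.ofReal (φ x * η t * ‖H t x‖ ^ 2) ∂(mass (V t)))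
      = ∫⁻ t in Ioc t₁ t₂, ∫⁻ x, ENNReal.ofReal (φ x * ‖H t x‖ ^ 2) ∂(mass (V t)) :=
    setLIntegral_congr_fun measurableSet_Ioc fun t ht => by
      simp only [hone t (Ioc_subset_Icc_self ht), mul_one]
  beta_reduce at hineq
  rw [hlhs, hone t₁ (left_mem_Icc.2 ht.le), hone t₂ (right_mem_Icc.2 ht.le)] at hineq
  simp only [mul_one] at hineq
  refine hineq.trans (EReal.coe_le_coe_iff.2 ?_)
  gcongr
  refine (le_abs_self _).trans ?_
  rw [← abs_of_nonneg (sub_nonneg.2 ht.le)]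
  rw [← Real.norm_eq_abs]
  refine intervalIntegral.norm_integral_le_of_norm_le_const_ae ?_
  filter_upwards [(ae_restrict_iff' measurableSet_Ici).1 hF.contactAngle] with t hangle htI
  rw [uIoc_of_le ht.le] at htI
  have htI' := Ioc_subset_Icc_self htI
  have ht0 : 0 ≤ t := ht₁.trans htI'.1
  obtain ⟨hV, hW⟩ := hF.varifold t ht0
  have hderiv : ∀ x, deriv (fun s => φ x * η s) t = 0 := by
    intro x
    have : (fun s => φ x * η s) =ᶠ[𝓝 t] fun _ => φ x := by
      filter_upwards [hη1 t htI'] with s hs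
      rw [hs, mul_one]
    rw [this.deriv_eq, deriv_const]
  simp only [hderiv, hone t htI', mul_one, integral_zero, add_zero, Real.norm_eq_abs]
  exact (integral_gradient_le hF.cos_nonneg hV hW (hangle ht0) hφ hB hK hKU hφK
    (hc t ht0)).trans (by linarith)

end Flow

/-! ### Weak convergence of Radon measures -/

section Limits

variable {n : ℕ} {U M : Set (E n)}

lemma IsC0Test.max_zero {φ : E n → ℝ} (hφ : IsC0Test U φ) : IsC0Test U fun x => max (φ x) 0 := by
  have h : tsupport (fun x => max (φ x) 0) ⊆ tsupport φ :=
    closure_mono fun x hx h0 => hx (by simp [h0])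
  exact ⟨hφ.continuous.max continuous_const,
    hφ.compactSupport.of_isClosed_subset (isClosed_tsupport _) h, h.trans hφ.support_subset⟩

lemma IsC0Test.neg {φ : E n → ℝ} (hφ : IsC0Test U φ) : IsC0Test U fun x => -φ x := by
  have h : tsupport (fun x => -φ x) ⊆ tsupport φ :=
    closure_mono fun x hx h0 => hx (by simp [h0])
  exact ⟨hφ.continuous.neg,
    hφ.compactSupport.of_isClosed_subset (isClosed_tsupport _) h, h.trans hφ.support_subset⟩

lemma abs_integral_sub_le {μ : Measure (E n)} (hμ : IsRadonOn U μ) {φ ψ χ : E n → ℝ}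
    (hφ : IsC0Test U φ) (hψ : IsC0Test U ψ) (hχ : IsC0Test U χ) {ε : ℝ}
    (h : ∀ x, |φ x - ψ x| ≤ ε * χ x) :
    |(∫ x, φ x ∂μ) - ∫ x, ψ x ∂μ| ≤ ε * ∫ x, χ x ∂μ := by
  rw [← integral_sub (hμ.integrable hφ) (hμ.integrable hψ), ← integral_const_mul,
    ← Real.norm_eq_abs]
  exact norm_integral_le_of_norm_le ((hμ.integrable hχ).const_mul ε) (Eventually.of_forall h)

/-- Inequality between Radon measures can be tested on admissible functions. -/
lemma integral_le_of_isAdmissible (hU : IsOpen U) (hM : IsC3Domain U M) {μ ν : Measure (E n)}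
    (hμ : IsRadonOn U μ) (hν : IsRadonOn U ν)
    (h : ∀ ψ, IsAdmissible U M ψ → ∫ x, ψ x ∂μ ≤ ∫ x, ψ x ∂ν) {φ : E n → ℝ}
    (hφ : IsC0Test U φ) (h0 : ∀ x, 0 ≤ φ x) : ∫ x, φ x ∂μ ≤ ∫ x, φ x ∂ν := by
  obtain ⟨χ, hχ, happ⟩ := exists_isAdmissible_near hU hM hφ h0
  have hlim : Tendsto (fun ε : ℝ => (∫ x, φ x ∂ν) + ε * ((∫ x, χ x ∂μ) + ∫ x, χ x ∂ν)) (𝓝[>] 0)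
      (𝓝 (∫ x, φ x ∂ν)) := by
    have : Continuous fun ε : ℝ => (∫ x, φ x ∂ν) + ε * ((∫ x, χ x ∂μ) + ∫ x, χ x ∂ν) := by fun_prop
    simpa using (this.tendsto 0).mono_left (nhdsWithin_le_nhds (s := Ioi 0))
  refine ge_of_tendsto hlim ?_
  filter_upwards [self_mem_nhdsWithin] with ε hε
  obtain ⟨ψ, hψ, hφψ⟩ := happ ε hε
  have h1 := abs_le.1 (abs_integral_sub_le hμ hφ hψ.isC0Test hχ.isC0Test hφψ)
  have h2 := abs_le.1 (abs_integral_sub_le hν hφ hψ.isC0Test hχ.isC0Test hφψ)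
  linarith [h ψ hψ]

/-- The approximation error is a small multiple of `∫ χ dμ_s`, which is eventually bounded above
since `χ` is itself admissible and its integrals converge. So the integrals of `φ` are Cauchy along
`l`. -/
lemma exists_tendsto_integral_of_isAdmissible (hU : IsOpen U) (hM : IsC3Domain U M)
    {l : Filter ℝ} [l.NeBot] {μ : ℝ → Measure (E n)} (hμ : ∀ᶠ s in l, IsRadonOn U (μ s))
    (h : ∀ ψ, IsAdmissible U M ψ → ∃ L, Tendsto (fun s => ∫ x, ψ x ∂(μ s)) l (𝓝 L))
    {φ : E n → ℝ} (hφ : IsC0Test U φ) :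
    ∃ L, Tendsto (fun s => ∫ x, φ x ∂(μ s)) l (𝓝 L) := by
  have key : ∀ φ : E n → ℝ, IsC0Test U φ → (∀ x, 0 ≤ φ x) →
      ∃ L, Tendsto (fun s => ∫ x, φ x ∂(μ s)) l (𝓝 L) := by
    intro φ hφ h0
    obtain ⟨χ, hχ, happ⟩ := exists_isAdmissible_near hU hM hφ h0
    obtain ⟨B, hB⟩ := h χ hχ
    rw [← cauchy_map_iff_exists_tendsto, Metric.cauchy_iff]
    refine ⟨inferInstance, fun ε hε => ?_⟩
    have hB0 : 0 < 4 * (|B| + 1) := by positivity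
    -- Eventually `∫ χ < B + 1`, so this accuracy costs at most `ε / 4`; the other `ε / 4` is for
    -- the convergence of `∫ ψ`.
    obtain ⟨ψ, hψ, hφψ⟩ := happ (ε / (4 * (|B| + 1))) (by positivity)
    obtain ⟨L, hL⟩ := h ψ hψ
    refine ⟨Metric.ball L (ε / 2), ?_, fun x hx y hy => ?_⟩
    · rw [mem_map]
      filter_upwards [hμ, hB.eventually_lt_const (lt_add_one B),
        hL.eventually (Metric.ball_mem_nhds L (show 0 < ε / 4 by positivity))] with s hs hBs hLs
      have h1 := abs_integral_sub_le hs hφ hψ.isC0Test hχ.isC0Test hφψ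
      have h2 : ε / (4 * (|B| + 1)) * ∫ x, χ x ∂(μ s) ≤ ε / 4 := by
        calc ε / (4 * (|B| + 1)) * ∫ x, χ x ∂(μ s) ≤ ε / (4 * (|B| + 1)) * (|B| + 1) := by
              gcongr
              linarith [le_abs_self B]
          _ = ε / 4 := by field_simp
      rw [mem_preimage, Metric.mem_ball, Real.dist_eq] at *
      calc |(∫ x, φ x ∂(μ s)) - L| ≤ |(∫ x, φ x ∂(μ s)) - ∫ x, ψ x ∂(μ s)|
            + |(∫ x, ψ x ∂(μ s)) - L| := abs_sub_le _ _ _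
        _ < ε / 2 := by linarith
    · rw [Metric.mem_ball] at hx hy
      linarith [dist_triangle_right x y L]
  obtain ⟨L₁, h₁⟩ := key _ hφ.max_zero fun x => le_max_right _ _
  obtain ⟨L₂, h₂⟩ := key _ hφ.neg.max_zero fun x => le_max_right _ _
  refine ⟨L₁ - L₂, (h₁.sub h₂).congr' ?_⟩
  filter_upwards [hμ] with s hs
  rw [← integral_sub (hs.integrable hφ.max_zero) (hs.integrable hφ.neg.max_zero)]
  congr 1 with x
  rcases le_total 0 (φ x) with hx | hx <;> simp [hx]

open scoped CompactlySupported in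
lemma isC0Test_extend (hU : IsOpen U) (f : C_c(U, ℝ)) :
    IsC0Test U (Function.extend Subtype.val f 0) :=
  ⟨f.hasCompactSupport.continuous_extend_zero hU f.continuous,
    f.hasCompactSupport.extend_zero continuous_subtype_val,
    (f.hasCompactSupport.tsupport_extend_zero_subset continuous_subtype_val).trans
      (Subtype.coe_image_subset _ _)⟩

lemma hasCompactSupport_restrict {φ : E n → ℝ} (hφ : IsC0Test U φ) :
    HasCompactSupport fun x : U => φ x := by
  have hc : IsCompact ((Subtype.val : U → E n) ⁻¹' tsupport φ) :=
    Topology.IsInducing.subtypeVal.isCompact_preimage' hφ.compactSupport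
      (by rw [Subtype.range_coe]; exact hφ.support_subset)
  exact HasCompactSupport.intro hc fun x hx => image_eq_zero_of_notMem_tsupport hx

/-- Radon measures on `U` whose integrals converge on all of `C^0_c(U)` converge weakly to a Radon
measure on `U`. -/
lemma exists_isRadonOn_tendsto (hU : IsOpen U) {l : Filter ℝ} [l.NeBot] {μ : ℝ → Measure (E n)}
    (hμ : ∀ᶠ s in l, IsRadonOn U (μ s))
    (h : ∀ φ, IsC0Test U φ → ∃ L, Tendsto (fun s => ∫ x, φ x ∂(μ s)) l (𝓝 L)) :
    ∃ ν, IsRadonOn U ν ∧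
      ∀ φ, IsC0Test U φ → Tendsto (fun s => ∫ x, φ x ∂(μ s)) l (𝓝 (∫ x, φ x ∂ν)) := by
  classical
  have : LocallyCompactSpace U := hU.locallyCompactSpace
  choose L hL using fun f : CompactlySupportedContinuousMap U ℝ => h _ (isC0Test_extend hU f)
  let Λ : CompactlySupportedContinuousMap U ℝ →ₗ[ℝ] ℝ :=
    { toFun := L
      map_add' := fun f g => by
        refine tendsto_nhds_unique (hL (f + g)) (((hL f).add (hL g)).congr' ?_)
        filter_upwards [hμ] with s hs
        rw [← integral_add (hs.integrable (isC0Test_extend hU f))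
          (hs.integrable (isC0Test_extend hU g))]
        congr 1 with x
        by_cases hx : ∃ a : U, (a : E n) = x <;> simp [Function.extend_def, hx]
      map_smul' := fun c f => by
        refine tendsto_nhds_unique (hL (c • f)) (((hL f).const_mul c).congr fun s => ?_)
        rw [← integral_const_mul]
        congr 1 with x
        by_cases hx : ∃ a : U, (a : E n) = x <;> simp [Function.extend_def, hx] }
  have hΛ : ∀ f, 0 ≤ f → 0 ≤ Λ f := fun f hf => by
    refine ge_of_tendsto' (hL f) fun s => integral_nonneg fun x => ?_
    by_cases hx : ∃ a : U, (a : E n) = x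
    · simpa [Function.extend_def, hx] using hf hx.choose
    · simp [hx]
  -- The representing measure is built on the locally compact space `U` and then pushed forward, so
  -- that it is finite on compact subsets of `U` but may blow up at the boundary of `U`.
  set ν₀ := RealRMK.rieszMeasure (PositiveLinearMap.mk₀ Λ hΛ)
  have hemb : MeasurableEmbedding (Subtype.val : U → E n) :=
    MeasurableEmbedding.subtype_coe hU.measurableSet
  refine ⟨ν₀.map Subtype.val, ⟨?_, fun K hKU hK => ?_⟩, fun φ hφ => ?_⟩
  · rw [hemb.map_apply]
    convert measure_empty (μ := ν₀)
    ext x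
    simp
  · rw [hemb.map_apply]
    exact (Topology.IsInducing.subtypeVal.isCompact_preimage' hK
      (by rw [Subtype.range_coe]; exact hKU)).measure_lt_top
  · let f : CompactlySupportedContinuousMap U ℝ :=
      ⟨⟨fun x => φ x, hφ.continuous.comp continuous_subtype_val⟩, hasCompactSupport_restrict hφ⟩
    have h1 : ∫ x, φ x ∂(ν₀.map Subtype.val) = L f := by
      rw [hemb.integral_map]
      exact RealRMK.integral_rieszMeasure (PositiveLinearMap.mk₀ Λ hΛ) f
    rw [h1]
    refine (hL f).congr fun s => ?_
    congr 1 with x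
    by_cases hx : x ∈ U
    · exact Subtype.val_injective.extend_apply f 0 ⟨x, hx⟩
    · rw [Function.extend_apply' _ _ _ fun ⟨a, ha⟩ => hx (ha ▸ a.2)]
      exact (image_eq_zero_of_notMem_tsupport fun h => hx (hφ.support_subset h)).symm

end Limits

/-! ### The main estimates -/

section Main

variable {n : ℕ} {U M : Set (E n)}

lemma exists_antitoneOn (hM : IsC3Domain U M) (C₀ : Set (E n) → ℝ≥0) {φ : E n → ℝ}
    (hφ : IsAdmissible U M φ) :
    ∃ C₁ : ℝ, 0 < C₁ ∧ ∀ θ V W H, IsBrakkeFlow U M θ V W H → HasMassBound M C₀ θ V W →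
      AntitoneOn (fun t : ℝ => (∫ x, φ x ∂(capMass θ (V t) (W t))) - C₁ * t) (Ici 0) := by
  obtain ⟨C, hC, hbound⟩ := exists_dissipation_bound hφ hφ.compactSupport hφ.support_subset
    subset_rfl (C₀ (tsupport φ ∩ M))
  refine ⟨C, hC, fun θ V W H hF hb t₁ ht₁ t₂ ht₂ ht => ?_⟩
  rcases ht.eq_or_lt with rfl | hlt
  · exact le_rfl
  have h1 := hbound θ V W H hF
    (fun t ht => hb.capMass_le hM hF hφ.compactSupport hφ.support_subset ht) t₁ t₂ ht₁ hlt
  -- The dissipation is nonnegative, so the right-hand side of the estimate is too; this is the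
  -- monotonicity.
  have h2 := EReal.coe_nonneg.1 ((EReal.coe_ennreal_nonneg _).trans h1)
  dsimp only
  linarith

lemma exists_lintegral_le (hM : IsC3Domain U M) {t₁ t₂ : ℝ} (ht₁ : 0 ≤ t₁) (ht : t₁ < t₂)
    {φ : E n → ℝ} (hφ : IsC0Test U φ) {K : Set (E n)} (hKU : K ⊆ U) (hK : IsCompact K)
    (hφK : tsupport φ ⊆ interior K) (c : ℝ≥0) :
    ∃ C₂ : ℝ, 0 < C₂ ∧ ∀ θ V W H, IsBrakkeFlow U M θ V W H →
      (∀ t : ℝ, 0 ≤ t → capMass θ (V t) (W t) K ≤ c) →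
      ∫⁻ t in Ioc t₁ t₂, ∫⁻ x, ENNReal.ofReal (φ x * ‖H t x‖ ^ 2) ∂(mass (V t))
        ≤ ENNReal.ofReal C₂ := by
  -- `φ` is merely continuous and cannot be tested directly. Keeping the support of the majorant
  -- inside `K` lets the mass bound on `K` alone suffice.
  obtain ⟨ψ, hψ, hψK, hφψ⟩ := exists_isAdmissible_ge hM isOpen_interior
    (interior_subset.trans hKU) hφ.continuous hφ.compactSupport hφK
  have hψK' : tsupport ψ ⊆ K := hψK.trans interior_subset
  obtain ⟨C, hC, hbound⟩ := exists_dissipation_bound hψ hK hKU hψK' c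
  obtain ⟨B, hB⟩ := hψ.compactSupport.exists_bound_of_continuous hψ.contDiff.continuous
  have hB0 : 0 ≤ B := (norm_nonneg _).trans (hB 0)
  have ht' : 0 < t₂ - t₁ := sub_pos.2 ht
  -- `B * c` bounds the initial value of `∫ ψ`; the final value is nonnegative and is dropped.
  refine ⟨B * c + C * (t₂ - t₁), by positivity, fun θ V W H hF hc => ?_⟩
  have h1 := hbound θ V W H hF hc t₁ t₂ ht₁ ht
  have hmass : ∫ x, ψ x ∂(capMass θ (V t₁) (W t₁)) ≤ B * c := by
    rw [← setIntegral_eq_integral_of_forall_compl_eq_zero (s := K) fun x hx =>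
      image_eq_zero_of_notMem_tsupport fun h => hx (hψK' h)]
    have hfin := (hc t₁ ht₁).trans_lt ENNReal.coe_lt_top
    refine (Real.le_norm_self _).trans ((norm_setIntegral_le_of_norm_le_const hfin
      fun x _ => hB x).trans ?_)
    gcongr
    exact ENNReal.toReal_mono ENNReal.coe_ne_top (hc t₁ ht₁)
  have hmass' : 0 ≤ ∫ x, ψ x ∂(capMass θ (V t₂) (W t₂)) := integral_nonneg hψ.nonneg
  have h2 : (∫⁻ t in Ioc t₁ t₂, ∫⁻ x, ENNReal.ofReal (ψ x * ‖H t x‖ ^ 2) ∂(mass (V t)))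
      ≤ ENNReal.ofReal (B * c + C * (t₂ - t₁)) := by
    rw [← EReal.coe_ennreal_le_coe_ennreal_iff, EReal.coe_ennreal_ofReal,
      max_eq_left (by positivity)]
    exact h1.trans (EReal.coe_le_coe_iff.2 (by linarith))
  refine le_trans ?_ h2
  gcongr with t x
  exact (le_abs_self _).trans (hφψ x)

lemma exists_right_limit (hU : IsOpen U) (hM : IsC3Domain U M) {C₀ : Set (E n) → ℝ≥0} {θ : ℝ}
    {V W : ℝ → Measure (E n × Gr n)} {H : ℝ → E n → E n} (hF : IsBrakkeFlow U M θ V W H)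
    (hb : HasMassBound M C₀ θ V W) {t : ℝ} (ht : 0 ≤ t) :
    ∃ ν, IsRadonOn U ν ∧
      (∀ φ, IsC0Test U φ → Tendsto (fun s => ∫ x, φ x ∂(capMass θ (V s) (W s))) (𝓝[>] t)
        (𝓝 (∫ x, φ x ∂ν))) ∧
      ∀ φ, IsC0Test U φ → (∀ x, 0 ≤ φ x) →
        ∫ x, φ x ∂ν ≤ ∫ x, φ x ∂(capMass θ (V t) (W t)) := by
  have hR : ∀ s, 0 ≤ s → IsRadonOn U (capMass θ (V s) (W s)) := fun s hs =>
    isRadonOn_capMass (hF.varifold s hs).1 (hF.varifold s hs).2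
  have hRev : ∀ᶠ s in 𝓝[>] t, IsRadonOn U (capMass θ (V s) (W s)) := by
    filter_upwards [self_mem_nhdsWithin] with s (hs : t < s) using hR s (ht.trans hs.le)
  have hadm : ∀ ψ, IsAdmissible U M ψ → ∃ L,
      Tendsto (fun s => ∫ x, ψ x ∂(capMass θ (V s) (W s))) (𝓝[>] t) (𝓝 L) ∧
      L ≤ ∫ x, ψ x ∂(capMass θ (V t) (W t)) := by
    intro ψ hψ
    obtain ⟨C, -, hC⟩ := exists_antitoneOn hM C₀ hψ
    have hanti := hC θ V W H hF hb
    have hsub : Ioo t (t + 1) ⊆ Ici (0 : ℝ) := fun s hs => ht.trans hs.1.le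
    have hle : ∀ s ∈ Ioo t (t + 1), (∫ x, ψ x ∂(capMass θ (V s) (W s))) - C * s
        ≤ (∫ x, ψ x ∂(capMass θ (V t) (W t))) - C * t := fun s hs =>
      hanti ht (hsub hs) hs.1.le
    -- The nonincreasing function is bounded above by its value at `t`, so its right limit is a
    -- finite supremum not exceeding that value; the continuous term `C * s` is then added back.
    have hlim := AntitoneOn.tendsto_nhdsWithin_Ioo_right (nonempty_Ioo.2 (lt_add_one t))
      (hanti.mono hsub) ⟨_, forall_mem_image.2 hle⟩
    have hlin : Tendsto (fun s : ℝ => C * s) (𝓝[>] t) (𝓝 (C * t)) :=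
      ((continuous_const_mul C).tendsto t).mono_left nhdsWithin_le_nhds
    refine ⟨_, (hlim.add hlin).congr fun s => by ring, ?_⟩
    have : _ ≤ (∫ x, ψ x ∂(capMass θ (V t) (W t))) - C * t := le_of_tendsto hlim (by
      filter_upwards [Ioo_mem_nhdsGT (lt_add_one t)] with s hs using hle s hs)
    linarith
  obtain ⟨ν, hν, hνlim⟩ := exists_isRadonOn_tendsto hU hRev fun φ hφ =>
    exists_tendsto_integral_of_isAdmissible hU hM hRev
      (fun ψ hψ => (hadm ψ hψ).imp fun _ h => h.1) hφ
  refine ⟨ν, hν, hνlim, fun φ hφ h0 => integral_le_of_isAdmissible hU hM hν (hR t ht)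
    (fun ψ hψ => ?_) hφ h0⟩
  obtain ⟨L, hL, hLle⟩ := hadm ψ hψ
  exact tendsto_nhds_unique (hνlim ψ hψ.isC0Test) hL ▸ hLle

lemma exists_left_limit (hU : IsOpen U) (hM : IsC3Domain U M) {C₀ : Set (E n) → ℝ≥0} {θ : ℝ}
    {V W : ℝ → Measure (E n × Gr n)} {H : ℝ → E n → E n} (hF : IsBrakkeFlow U M θ V W H)
    (hb : HasMassBound M C₀ θ V W) {t : ℝ} (ht : 0 < t) :
    ∃ ν, IsRadonOn U ν ∧
      (∀ φ, IsC0Test U φ → Tendsto (fun s => ∫ x, φ x ∂(capMass θ (V s) (W s))) (𝓝[<] t)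
        (𝓝 (∫ x, φ x ∂ν))) ∧
      ∀ φ, IsC0Test U φ → (∀ x, 0 ≤ φ x) →
        ∫ x, φ x ∂(capMass θ (V t) (W t)) ≤ ∫ x, φ x ∂ν := by
  have hR : ∀ s, 0 ≤ s → IsRadonOn U (capMass θ (V s) (W s)) := fun s hs =>
    isRadonOn_capMass (hF.varifold s hs).1 (hF.varifold s hs).2
  have hRev : ∀ᶠ s in 𝓝[<] t, IsRadonOn U (capMass θ (V s) (W s)) := by
    filter_upwards [Ioo_mem_nhdsLT ht] with s hs using hR s hs.1.le
  have hadm : ∀ ψ, IsAdmissible U M ψ → ∃ L,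
      Tendsto (fun s => ∫ x, ψ x ∂(capMass θ (V s) (W s))) (𝓝[<] t) (𝓝 L) ∧
      ∫ x, ψ x ∂(capMass θ (V t) (W t)) ≤ L := by
    intro ψ hψ
    obtain ⟨C, -, hC⟩ := exists_antitoneOn hM C₀ hψ
    have hanti := hC θ V W H hF hb
    have hsub : Ioo 0 t ⊆ Ici (0 : ℝ) := fun s hs => hs.1.le
    have hle : ∀ s ∈ Ioo 0 t, (∫ x, ψ x ∂(capMass θ (V t) (W t))) - C * t
        ≤ (∫ x, ψ x ∂(capMass θ (V s) (W s))) - C * s := fun s hs =>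
      hanti (hsub hs) ht.le hs.2.le
    -- Here the value at `t` is a lower bound, and the left limit is an infimum at least as large.
    have hlim := AntitoneOn.tendsto_nhdsWithin_Ioo_left (nonempty_Ioo.2 ht)
      (hanti.mono hsub) ⟨_, forall_mem_image.2 hle⟩
    have hlin : Tendsto (fun s : ℝ => C * s) (𝓝[<] t) (𝓝 (C * t)) :=
      ((continuous_const_mul C).tendsto t).mono_left nhdsWithin_le_nhds
    refine ⟨_, (hlim.add hlin).congr fun s => by ring, ?_⟩
    have : (∫ x, ψ x ∂(capMass θ (V t) (W t))) - C * t ≤ _ := ge_of_tendsto hlim (by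
      filter_upwards [Ioo_mem_nhdsLT ht] with s hs using hle s hs)
    linarith
  obtain ⟨ν, hν, hνlim⟩ := exists_isRadonOn_tendsto hU hRev fun φ hφ =>
    exists_tendsto_integral_of_isAdmissible hU hM hRev
      (fun ψ hψ => (hadm ψ hψ).imp fun _ h => h.1) hφ
  refine ⟨ν, hν, hνlim, fun φ hφ h0 => integral_le_of_isAdmissible hU hM (hR t ht.le) hν
    (fun ψ hψ => ?_) hφ h0⟩
  obtain ⟨L, hL, hLle⟩ := hadm ψ hψ
  exact tendsto_nhds_unique (hνlim ψ hψ.isC0Test) hL ▸ hLle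

end Main

end CapillaryBrakke

end

theorem lemma4p1 (n : ℕ) (hn : 1 ≤ n) (U M : Set (CapillaryBrakke.E n)) (hU : IsOpen U)
    (hM : CapillaryBrakke.IsC3Domain U M) :
    -- (1) almost monotonicity; `C₁` depends only on `C₀` and `φ`
    (∀ (C₀ : Set (CapillaryBrakke.E n) → ℝ≥0) (φ : CapillaryBrakke.E n → ℝ),
      CapillaryBrakke.IsAdmissible U M φ →
      ∃ C₁ : ℝ, 0 < C₁ ∧ ∀ θ V W H, CapillaryBrakke.IsBrakkeFlow U M θ V W H →
        CapillaryBrakke.HasMassBound M C₀ θ V W →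
        AntitoneOn (fun t : ℝ => (∫ x, φ x ∂(CapillaryBrakke.capMass θ (V t) (W t))) - C₁ * t)
          (Ici 0)) ∧
    -- (2) one-sided limits, as Radon measures on `U`
    (∀ (C₀ : Set (CapillaryBrakke.E n) → ℝ≥0) θ V W H,
      CapillaryBrakke.IsBrakkeFlow U M θ V W H → CapillaryBrakke.HasMassBound M C₀ θ V W →
      (∀ t : ℝ, 0 ≤ t → ∃ ν, CapillaryBrakke.IsRadonOn U ν ∧
        (∀ φ, CapillaryBrakke.IsC0Test U φ →
          Tendsto (fun s => ∫ x, φ x ∂(CapillaryBrakke.capMass θ (V s) (W s))) (𝓝[>] t)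
            (𝓝 (∫ x, φ x ∂ν))) ∧
        ∀ φ, CapillaryBrakke.IsC0Test U φ → (∀ x, 0 ≤ φ x) →
          ∫ x, φ x ∂ν ≤ ∫ x, φ x ∂(CapillaryBrakke.capMass θ (V t) (W t))) ∧
      (∀ t : ℝ, 0 < t → ∃ ν, CapillaryBrakke.IsRadonOn U ν ∧
        (∀ φ, CapillaryBrakke.IsC0Test U φ →
          Tendsto (fun s => ∫ x, φ x ∂(CapillaryBrakke.capMass θ (V s) (W s))) (𝓝[<] t)
            (𝓝 (∫ x, φ x ∂ν))) ∧
        ∀ φ, CapillaryBrakke.IsC0Test U φ → (∀ x, 0 ≤ φ x) →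
          ∫ x, φ x ∂(CapillaryBrakke.capMass θ (V t) (W t)) ≤ ∫ x, φ x ∂ν)) ∧
    -- (3) space-time `L²` bound; `C₂` depends on the flow only through the bound `c = C₀(K)`
    (∀ (t₁ t₂ : ℝ), 0 ≤ t₁ → t₁ < t₂ → ∀ φ : CapillaryBrakke.E n → ℝ,
      CapillaryBrakke.IsC0Test U φ → (∀ x, 0 ≤ φ x) →
      ∀ K ⊆ U, IsCompact K → tsupport φ ⊆ interior K → ∀ c : ℝ≥0,
      ∃ C₂ : ℝ, 0 < C₂ ∧ ∀ θ V W H, CapillaryBrakke.IsBrakkeFlow U M θ V W H →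
        (∀ t : ℝ, 0 ≤ t → CapillaryBrakke.capMass θ (V t) (W t) K ≤ c) →
        ∫⁻ t in Ioc t₁ t₂, ∫⁻ x, ENNReal.ofReal (φ x * ‖H t x‖ ^ 2)
            ∂(CapillaryBrakke.mass (V t)) ≤ ENNReal.ofReal C₂) := by
  refine ⟨fun C₀ φ hφ => CapillaryBrakke.exists_antitoneOn hM C₀ hφ, fun C₀ θ V W H hF hb =>
    ⟨fun t ht => CapillaryBrakke.exists_right_limit hU hM hF hb ht,
      fun t ht => CapillaryBrakke.exists_left_limit hU hM hF hb ht⟩,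
    fun t₁ t₂ ht₁ ht φ hφ _ K hKU hK hφK c =>
      CapillaryBrakke.exists_lintegral_le hM ht₁ ht hφ hKU hK hφK c⟩
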